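/- A quantitative reachability game with penalties consists of a finite directed graph $(V,E)$ in which every vertex has at least one successor, a partition $V=V_1\uplus V_2$ of the vertices between Player 1 and Player 2, a weight function $w:E\to\mathbb N$, a penalty function $\pi:E\to\mathbb N$, and a target set $F\subseteq V$. The cost of a play (an infinite path) $\rho=\rho_0\rho_1\cdots$ is $\sum_{i<\ell} w(\rho_i,\rho_{i+1})$, where $\ell$ is the least index with $\rho_\ell\in F$, and $+\infty$ if there is no such index. A multi-strategy $\Theta$ of Player 1 from $v$ maps each finite path $hu$ that starts in $v$ and ends in a vertex $u\in V_1$ to a nonempty set $\Theta(hu)$ of successors of $u$. A play $\rho$ from $v$ is consistent with $\Theta$ if $\rho_{i+1}\in\Theta(\rho_0\cdots\rho_i)$ whenever $\rho_i\in V_1$; its penalty is $$\sum_{i\ge 0,\ \rho_i\in V_1}\ \ \sum_{u\in \mathrm{Succ}(\rho_i)\setminus\Theta(\rho_0\cdots\rho_i)}\pi(\rho_i,u)\ \in\ \mathbb N\cup\{\infty\}.$$ Let $C(\Theta)$ and $P(\Theta)$ be the suprema of the costs and of the penalties of the plays from $v$ that are consistent with $\Theta$. The Pareto frontier $\mathrm{Pareto}(v)$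 is the set of minimal elements, for the componentwise order, of $$\{(x,y)\in(\mathbb N\cup\{\infty\})^2 \mid \text{there is a multi-strategy } \Theta \text{ of Player 1 from } v \text{ with } C(\Theta)\le x \text{ and } P(\Theta)\le y\}.$$ **Proposition.** Given a quantitative reachability game with penalties and an initial vertex $v_0$, the set $\mathrm{Pareto}(v_0)$ can be computed in exponential time. That is, there are an algorithm and a polynomial $q$ such that, on every such input of size $s$ (adjacency lists, with weights and penalties written in binary), the algorithm outputs within $2^{q(s)}$ steps a list without repetitions of exactly the elements of $\mathrm{Pareto}(v_0)$. -/

import Mathlib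

namespace PermissiveReach

/-! ## Quantitative reachability games with penalties -/

/-- A quantitative (that is, 1-weighted) reachability game with penalties. Its vertices are
`Fin n`; `succ v` is the set of successors of `v`, so that `(v, u)` is an edge iff `u ∈ succ v`;
`V₁` is the set of vertices of Player 1 and its complement `V₂` the set of vertices of Player 2.
Only the values of `weight` and `penalty` on edges are ever used. Every vertex has a successor,
so that a play can always be continued. -/
structure Game (n : ℕ) where
  V₁ : Finset (Fin n)
  succ : Fin n → Finset (Fin n)
  succ_nonempty : ∀ v, (succ v).Nonempty
  weight : Fin n → Fin n → ℕ
  penalty : Fin n → Fin n → ℕ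
  target : Finset (Fin n)

variable {n : ℕ}

/-- `h` is a history starting in `v`: a nonempty finite path of the graph with first vertex `v`. -/
def Game.IsHistory (G : Game n) (v : Fin n) (h : List (Fin n)) : Prop :=
  h.head? = some v ∧ h.IsChain (fun a b => b ∈ G.succ a)

/-- A multi-strategy of Player 1 from `v`: to each history from `v` that ends in a vertex `u` of
Player 1 it assigns a nonempty set of successors of `u`. Its values on other lists are
irrelevant. -/
structure MultiStrategy (G : Game n) (v : Fin n) where
  choice : List (Fin n) → Finset (Fin n)
  choice_nonempty : ∀ h u, G.IsHistory v h → h.getLast? = some u → u ∈ G.V₁ → (choice h).Nonempty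
  choice_subset : ∀ h u, G.IsHistory v h → h.getLast? = some u → u ∈ G.V₁ → choice h ⊆ G.succ u

namespace MultiStrategy

variable {G : Game n} {v : Fin n}

/-- The histories from `v` that are consistent with the multi-strategy `Θ`. -/
inductive OutcomeHistory (Θ : MultiStrategy G v) : List (Fin n) → Prop
  | start : OutcomeHistory Θ [v]
  | player₁ {h : List (Fin n)} {u u' : Fin n} : OutcomeHistory Θ h → h.getLast? = some u →
      u ∈ G.V₁ → u' ∈ Θ.choice h → OutcomeHistory Θ (h ++ [u'])
  | player₂ {h : List (Fin n)} {u u' : Fin n} : OutcomeHistory Θ h → h.getLast? = some u →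
      u ∉ G.V₁ → u' ∈ G.succ u → OutcomeHistory Θ (h ++ [u'])

end MultiStrategy

/-- The finite prefix `ρ 0, …, ρ k` of the infinite sequence `ρ`. -/
def playPrefix (ρ : ℕ → Fin n) (k : ℕ) : List (Fin n) :=
  (List.range (k + 1)).map ρ

open Classical in
/-- The cost of a play: the sum of the weights of its edges up to the first visit of the target
set, and `⊤` if the target set is never visited. -/
noncomputable def Game.cost (G : Game n) (ρ : ℕ → Fin n) : ℕ∞ :=
  if hρ : ∃ l, ρ l ∈ G.target then
    ((∑ i ∈ Finset.range (Nat.find hρ), G.weight (ρ i) (ρ (i + 1)) : ℕ) : ℕ∞)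
  else ⊤

namespace MultiStrategy

variable {G : Game n} {v : Fin n}

/-- The plays from `v` that are consistent with `Θ`: all their finite prefixes are. -/
def outcome (Θ : MultiStrategy G v) : Set (ℕ → Fin n) :=
  {ρ | ∀ k, Θ.OutcomeHistory (playPrefix ρ k)}

/-- The worst ensured cost of `Θ`. -/
noncomputable def worstCost (Θ : MultiStrategy G v) : ℕ∞ :=
  sSup (G.cost '' Θ.outcome)

/-- The penalty accumulated along the first `k` vertices `ρ 0, …, ρ (k - 1)` of the play `ρ`: at
each vertex of Player 1, the penalties of the edges that `Θ` blocks there. -/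
def prefixPenalty (Θ : MultiStrategy G v) (ρ : ℕ → Fin n) : ℕ → ℕ
  | 0 => 0
  | k + 1 => prefixPenalty Θ ρ k +
      if ρ k ∈ G.V₁ then
        ∑ u ∈ G.succ (ρ k) \ Θ.choice (playPrefix ρ k), G.penalty (ρ k) u
      else 0

/-- The penalty along a play: the limit (supremum) of the nondecreasing sequence of the penalties
of its prefixes. -/
noncomputable def playPenalty (Θ : MultiStrategy G v) (ρ : ℕ → Fin n) : ℕ∞ :=
  ⨆ k, (Θ.prefixPenalty ρ k : ℕ∞)

/-- The penalty of `Θ`: the worst penalty along a play consistent with `Θ`. -/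
noncomputable def worstPenalty (Θ : MultiStrategy G v) : ℕ∞ :=
  sSup (Θ.playPenalty '' Θ.outcome)

end MultiStrategy

/-- The pairs (cost, penalty) that Player 1 can ensure from `v` by a multi-strategy; the order on
`ℕ∞ × ℕ∞` is the componentwise one. -/
def Game.ensured (G : Game n) (v : Fin n) : Set (ℕ∞ × ℕ∞) :=
  {x | ∃ Θ : MultiStrategy G v, (Θ.worstCost, Θ.worstPenalty) ≤ x}

/-- The Pareto frontier from `v`: the minimal ensured pairs for the componentwise order. -/
def Game.pareto (G : Game n) (v : Fin n) : Set (ℕ∞ × ℕ∞) :=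
  {x | Minimal (· ∈ G.ensured v) x}

/-! ## A model of computation with a step count

First-order recursive programs over S-expressions whose atoms are natural numbers, with unit cost
per operation. The only arithmetic is addition and truncated subtraction (no multiplication), so
that `t` steps on an input of size `s` only build numbers of at most `s + t + O(1)` binary digits
and at most `t` new pairs (data being shared): up to a polynomial, time is Turing machine time. -/

/-- S-expressions over the natural numbers. -/
inductive Data
  | nat (k : ℕ)
  | pair (a b : Data)

namespace Data

/-- The size of a datum, with numbers written in binary. -/
def size : Data → ℕ
  | nat k => 1 + Nat.size k
  | pair a b => 1 + a.size + b.size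

/-- The first component of a pair (`0` for an atom). -/
def fst : Data → Data
  | nat _ => nat 0
  | pair a _ => a

/-- The second component of a pair (`0` for an atom). -/
def snd : Data → Data
  | nat _ => nat 0
  | pair _ b => b

/-- The value of an atom (`0` for a pair). -/
def val : Data → ℕ
  | nat k => k
  | pair _ _ => 0

/-- `1` for a pair and `0` for an atom. -/
def isPair : Data → ℕ
  | nat _ => 0
  | pair _ _ => 1

/-- The list `a₁, …, aₘ` as the datum `(a₁, (a₂, … (aₘ, 0)))`. -/
def ofList : List Data → Data
  | [] => nat 0
  | a :: l => pair a (ofList l)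

end Data

/-- The expressions of the programming language; each is evaluated on one argument. -/
inductive Code
  | arg
  | const (k : ℕ)
  | fst (e : Code)
  | snd (e : Code)
  | pair (e f : Code)
  | isPair (e : Code)
  | add (e f : Code)
  | sub (e f : Code)
  | ite (c e f : Code)
  | comp (f e : Code)
  | call (i : ℕ) (e : Code)

/-- A program is a finite list of possibly mutually recursive unary functions, given by their
bodies. -/
abbrev Program := List Code

/-- `Exec P e x y t`: with the functions of `P` at hand, the expression `e` evaluates on the
argument `x` to the value `y` in exactly `t` steps (call by value, one step per operation). -/
inductive Exec (P : Program) : Code → Data → Data → ℕ → Prop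
  | arg {x : Data} : Exec P .arg x x 1
  | const {k : ℕ} {x : Data} : Exec P (.const k) x (.nat k) 1
  | fst {e : Code} {x y : Data} {t : ℕ} : Exec P e x y t → Exec P (.fst e) x y.fst (t + 1)
  | snd {e : Code} {x y : Data} {t : ℕ} : Exec P e x y t → Exec P (.snd e) x y.snd (t + 1)
  | pair {e f : Code} {x y z : Data} {s t : ℕ} : Exec P e x y s → Exec P f x z t →
      Exec P (.pair e f) x (.pair y z) (s + t + 1)
  | isPair {e : Code} {x y : Data} {t : ℕ} : Exec P e x y t →
      Exec P (.isPair e) x (.nat y.isPair) (t + 1)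
  | add {e f : Code} {x y z : Data} {s t : ℕ} : Exec P e x y s → Exec P f x z t →
      Exec P (.add e f) x (.nat (y.val + z.val)) (s + t + 1)
  | sub {e f : Code} {x y z : Data} {s t : ℕ} : Exec P e x y s → Exec P f x z t →
      Exec P (.sub e f) x (.nat (y.val - z.val)) (s + t + 1)
  | ite_true {c e f : Code} {x b y : Data} {s t : ℕ} : Exec P c x b s → b.val ≠ 0 →
      Exec P e x y t → Exec P (.ite c e f) x y (s + t + 1)
  | ite_false {c e f : Code} {x b y : Data} {s t : ℕ} : Exec P c x b s → b.val = 0 →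
      Exec P f x y t → Exec P (.ite c e f) x y (s + t + 1)
  | comp {f e : Code} {x y z : Data} {s t : ℕ} : Exec P e x y s → Exec P f y z t →
      Exec P (.comp f e) x z (s + t + 1)
  | call {i : ℕ} {e b : Code} {x y z : Data} {s t : ℕ} : Exec P e x y s → P[i]? = some b →
      Exec P b y z t → Exec P (.call i e) x z (s + t + 1)

/-- The program `P`, started in its function number `0` on the input `x`, halts after exactly `t`
steps with the output `y`. -/
def Program.Computes (P : Program) (x y : Data) (t : ℕ) : Prop :=
  Exec P (.call 0 .arg) x y t

/-! ## Inputs and outputs as data -/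

/-- The edge from `v` to `u`, as the triple of its end, its weight and its penalty. -/
def Game.edgeData (G : Game n) (v u : Fin n) : Data :=
  .pair (.nat u) (.pair (.nat (G.weight v u)) (.nat (G.penalty v u)))

/-- The vertex `v`, as the triple of its owner (`1` for Player 1, `0` for Player 2), its
membership in the target set, and the list of its outgoing edges. -/
def Game.vertexData (G : Game n) (v : Fin n) : Data :=
  .pair (.nat (if v ∈ G.V₁ then 1 else 0))
    (.pair (.nat (if v ∈ G.target then 1 else 0))
      (Data.ofList (((List.finRange n).filter (· ∈ G.succ v)).map (G.edgeData v))))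

/-- The game `G` with initial vertex `v₀`, as an initial vertex and adjacency lists, with binary
weights and penalties. -/
def Game.toData (G : Game n) (v₀ : Fin n) : Data :=
  .pair (.nat v₀) (Data.ofList ((List.finRange n).map G.vertexData))

/-- A natural number is an atom; `∞` is the pair `(0, 0)`. -/
noncomputable def enatData (x : ℕ∞) : Data :=
  if x = ⊤ then .pair (.nat 0) (.nat 0) else .nat x.toNat

/-- A list of pairs of elements of `ℕ ∪ {∞}`, as a datum. -/
noncomputable def pairsData (L : List (ℕ∞ × ℕ∞)) : Data :=
  Data.ofList (L.map fun x => .pair (enatData x.1) (enatData x.2))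

end PermissiveReach

namespace PermissiveReach

variable {n : ℕ}

/-! ## Plays consistent with a multi-strategy -/

/-! Only the part of a play before its first visit of the target matters: afterwards the cost is
fixed and nothing needs to be blocked. So a finite cost `c` together with a penalty bound is a
matter of winning a finite-horizon game, `Game.Win`, with cost budget `c + 1`. At each vertex a set
of successors is kept, the blocked edges are paid for, and one common penalty allowance is left for
all kept successors. The cost budget is strict, so that truncated subtraction turns overspending
into the losing budget `0`.

A win unfolds into a multi-strategy by gluing (`Game.Win.exists_multiStrategy`). Conversely
(`MultiStrategy.exists_win`), suppose that a multi-strategy of finite worst cost started in a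
position won in no number of steps. As branching is finite, some consistent play would stay in such
positions until it visits the target, which its finite cost forces it to do; but there the position
is won.

A horizon of `n` steps suffices (`Win.card_steps`): if `k` is the least number of steps, some path
has successors that need exactly `k - 1`, `k - 2`, … steps within shrinking budgets, and its
vertices are distinct.

Let `f b` be the least penalty for budget `b` and horizon `n`. It is antitone, and constant from `n
* W + 1` on, where `W` bounds the weights. The Pareto points of finite cost are the pairs `(c, f (c
+ 1))` at the strict drops `f (c + 1) < f c`, and `(∞, 0)` is added exactly when `f (n * W + 1) >
0`.

The program evaluates `f` by plain recursion. Enumerating the kept sets costs a factor of about `2 ^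
(n + 1)` at each of `n` levels, so one value takes `2 ^ O(n²)` steps. Taking for `W` the sum of all
atoms of the input, which is below `2 ^ s` for size `s`, leaves exponentially many budgets to try.
-/

theorem playPrefix_succ (ρ : ℕ → Fin n) (k : ℕ) :
    playPrefix ρ (k + 1) = playPrefix ρ k ++ [ρ (k + 1)] := by
  simp [playPrefix, List.range_succ]

theorem playPrefix_zero (ρ : ℕ → Fin n) : playPrefix ρ 0 = [ρ 0] := by
  simp [playPrefix]

theorem playPrefix_succ_cons (ρ : ℕ → Fin n) (k : ℕ) :
    playPrefix ρ (k + 1) = ρ 0 :: playPrefix (fun i => ρ (i + 1)) k := by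
  simp [playPrefix, List.range_succ_eq_map, Function.comp_def]

theorem getLast?_playPrefix (ρ : ℕ → Fin n) (k : ℕ) :
    (playPrefix ρ k).getLast? = some (ρ k) := by
  simp [playPrefix, List.range_succ]

/-- The moves available at `v`: Player 1 allows a nonempty set of successors, and all successors
are available at a vertex of Player 2. -/
def Game.Legal (G : Game n) (v : Fin n) (S : Finset (Fin n)) : Prop :=
  S ⊆ G.succ v ∧ S.Nonempty ∧ (v ∉ G.V₁ → S = G.succ v)

theorem Game.legal_succ (G : Game n) (v : Fin n) : G.Legal v (G.succ v) :=
  ⟨subset_rfl, G.succ_nonempty v, fun _ => rfl⟩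

/-- The total penalty of the edges from `v` that are blocked when only those to `S` are kept. -/
def Game.blocked (G : Game n) (v : Fin n) (S : Finset (Fin n)) : ℕ :=
  ∑ u ∈ G.succ v \ S, G.penalty v u

theorem Game.isHistory_concat {G : Game n} {v : Fin n} {h : List (Fin n)} {u u' : Fin n}
    (hh : G.IsHistory v h) (hu : h.getLast? = some u) (hu' : u' ∈ G.succ u) :
    G.IsHistory v (h ++ [u']) := by
  refine ⟨by simp [hh.1], ?_⟩
  rw [List.isChain_append]
  refine ⟨hh.2, by simp, ?_⟩
  intro x hx y hy
  simp_all

namespace MultiStrategy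

variable {G : Game n} {v : Fin n}

/-- The vertices to which a play that has reached `u` by the history `h` may continue. -/
def allowed (Θ : MultiStrategy G v) (h : List (Fin n)) (u : Fin n) : Finset (Fin n) :=
  if u ∈ G.V₁ then Θ.choice h else G.succ u

theorem legal_allowed (Θ : MultiStrategy G v) {h : List (Fin n)} {u : Fin n}
    (hh : G.IsHistory v h) (hu : h.getLast? = some u) : G.Legal u (Θ.allowed h u) := by
  unfold allowed
  split_ifs with h1
  · exact ⟨Θ.choice_subset h u hh hu h1, Θ.choice_nonempty h u hh hu h1, fun h2 => absurd h1 h2⟩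
  · exact G.legal_succ u

theorem OutcomeHistory.concat {Θ : MultiStrategy G v} {h : List (Fin n)} {u u' : Fin n}
    (hh : Θ.OutcomeHistory h) (hu : h.getLast? = some u) (hu' : u' ∈ Θ.allowed h u) :
    Θ.OutcomeHistory (h ++ [u']) := by
  unfold allowed at hu'
  split_ifs at hu' with h1
  · exact hh.player₁ hu h1 hu'
  · exact hh.player₂ hu h1 hu'

theorem OutcomeHistory.eq_or_concat {Θ : MultiStrategy G v} {h' : List (Fin n)}
    (hh : Θ.OutcomeHistory h') :
    h' = [v] ∨ ∃ h u u', h' = h ++ [u'] ∧ Θ.OutcomeHistory h ∧ h.getLast? = some u ∧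
      u' ∈ Θ.allowed h u := by
  cases hh with
  | start => exact Or.inl rfl
  | player₁ h1 h2 h3 h4 => exact Or.inr ⟨_, _, _, rfl, h1, h2, by simp [allowed, h3, h4]⟩
  | player₂ h1 h2 h3 h4 => exact Or.inr ⟨_, _, _, rfl, h1, h2, by simp [allowed, h3, h4]⟩

theorem OutcomeHistory.ne_nil {Θ : MultiStrategy G v} {h : List (Fin n)}
    (hh : Θ.OutcomeHistory h) : h ≠ [] := by
  rcases hh.eq_or_concat with rfl | ⟨h, u, u', rfl, -⟩ <;> simp

theorem mem_outcome_iff (Θ : MultiStrategy G v) (ρ : ℕ → Fin n) :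
    ρ ∈ Θ.outcome ↔ ρ 0 = v ∧ ∀ k, ρ (k + 1) ∈ Θ.allowed (playPrefix ρ k) (ρ k) := by
  constructor
  · intro h
    constructor
    · have h0 := h 0
      rw [playPrefix_zero] at h0
      rcases h0.eq_or_concat with h1 | ⟨h, u, u', h1, h2, -⟩
      · simpa using h1
      · have := h2.ne_nil
        have h3 := congrArg List.length h1
        simp at h3
        contradiction
    · intro k
      have hk := h (k + 1)
      rw [playPrefix_succ] at hk
      rcases hk.eq_or_concat with h1 | ⟨h, u, u', h1, h2, h3, h4⟩
      · have h3 := congrArg List.length h1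
        simp [playPrefix] at h3
      · obtain ⟨rfl, h5⟩ := List.append_inj' h1 rfl
        rw [getLast?_playPrefix] at h3
        simp at h3 h5
        subst h3
        rwa [h5]
  · rintro ⟨h0, hs⟩ k
    induction k with
    | zero => rw [playPrefix_zero, h0]; exact .start
    | succ k ih =>
      rw [playPrefix_succ]
      exact ih.concat (getLast?_playPrefix ρ k) (hs k)

theorem prefixPenalty_succ (Θ : MultiStrategy G v) (ρ : ℕ → Fin n) (k : ℕ) :
    Θ.prefixPenalty ρ (k + 1) =
      Θ.prefixPenalty ρ k + G.blocked (ρ k) (Θ.allowed (playPrefix ρ k) (ρ k)) := by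
  by_cases h : ρ k ∈ G.V₁ <;> simp [prefixPenalty, Game.blocked, allowed, h]

theorem playPenalty_le_iff (Θ : MultiStrategy G v) (ρ : ℕ → Fin n) (y : ℕ∞) :
    Θ.playPenalty ρ ≤ y ↔ ∀ k, (Θ.prefixPenalty ρ k : ℕ∞) ≤ y := iSup_le_iff

theorem worstPenalty_le_iff (Θ : MultiStrategy G v) (y : ℕ∞) :
    Θ.worstPenalty ≤ y ↔ ∀ ρ ∈ Θ.outcome, ∀ k, (Θ.prefixPenalty ρ k : ℕ∞) ≤ y := by
  simp [worstPenalty, playPenalty_le_iff]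

theorem worstCost_le_iff (Θ : MultiStrategy G v) (x : ℕ∞) :
    Θ.worstCost ≤ x ↔ ∀ ρ ∈ Θ.outcome, G.cost ρ ≤ x := by
  simp [worstCost]

/-- The multi-strategy that blocks no edge. -/
def full (G : Game n) (v : Fin n) : MultiStrategy G v where
  choice h := h.getLast?.elim ∅ G.succ
  choice_nonempty h u _ hu _ := by simpa [hu] using G.succ_nonempty u
  choice_subset h u _ hu _ := by simp [hu]

theorem prefixPenalty_full (ρ : ℕ → Fin n) (k : ℕ) : (full G v).prefixPenalty ρ k = 0 := by
  induction k with
  | zero => rfl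
  | succ k ih =>
    rw [prefixPenalty_succ, ih]
    simp [Game.blocked, allowed, full, getLast?_playPrefix]

end MultiStrategy

/-! ### Cost of a play in terms of its tail -/

theorem Game.cost_of_mem_target {G : Game n} {ρ : ℕ → Fin n} (h : ρ 0 ∈ G.target) :
    G.cost ρ = 0 := by
  have hex : ∃ l, ρ l ∈ G.target := ⟨0, h⟩
  have hf : Nat.find hex = 0 := by simpa using h
  simp [Game.cost, hex, hf]

theorem Game.cost_of_notMem_target {G : Game n} {ρ : ℕ → Fin n} (h : ρ 0 ∉ G.target) :
    G.cost ρ = G.weight (ρ 0) (ρ 1) + G.cost (fun i => ρ (i + 1)) := by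
  classical
  by_cases hex : ∃ l, ρ (l + 1) ∈ G.target
  · have hex' : ∃ l, ρ l ∈ G.target := let ⟨l, hl⟩ := hex; ⟨l + 1, hl⟩
    have hf : Nat.find hex' = Nat.find hex + 1 := Nat.find_comp_succ hex' hex h
    rw [Game.cost, dif_pos hex', Game.cost, dif_pos hex]
    have : Nat.find hex' = Nat.find hex + 1 := hf
    simp only [this]
    rw [Finset.sum_range_succ', add_comm]
    push_cast
    rfl
  · have hex' : ¬ ∃ l, ρ l ∈ G.target := by
      rintro ⟨_ | l, hl⟩
      exacts [h hl, hex ⟨l, hl⟩]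
    rw [Game.cost, dif_neg hex', Game.cost, dif_neg hex]
    simp

/-! ## Winning within a budget -/

/-- From `v`, Player 1 can reach the target set in at most `k` steps with cost less than `b` and
penalty at most `p`. -/
def Game.Win (G : Game n) : ℕ → Fin n → ℕ → ℕ → Prop
  | 0, v, b, _ => 0 < b ∧ v ∈ G.target
  | k + 1, v, b, p => 0 < b ∧ (v ∈ G.target ∨ ∃ S, G.Legal v S ∧ ∃ p', G.blocked v S + p' ≤ p ∧
      ∀ u ∈ S, G.Win k u (b - G.weight v u) p')

namespace Game

variable {G : Game n}

theorem Win.pos {k : ℕ} {v : Fin n} {b p : ℕ} (h : G.Win k v b p) : 0 < b := by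
  cases k <;> exact h.1

theorem win_of_mem_target {v : Fin n} (h : v ∈ G.target) (k : ℕ) {b : ℕ} (hb : 0 < b) (p : ℕ) :
    G.Win k v b p := by
  cases k
  · exact ⟨hb, h⟩
  · exact ⟨hb, Or.inl h⟩

theorem Win.succ {k : ℕ} {v : Fin n} {b p : ℕ} (h : G.Win k v b p) : G.Win (k + 1) v b p := by
  induction k generalizing v b p with
  | zero => exact ⟨h.1, Or.inl h.2⟩
  | succ k ih =>
    refine ⟨h.1, h.2.imp_right ?_⟩
    rintro ⟨S, hS, p', hp', h'⟩
    exact ⟨S, hS, p', hp', fun u hu => ih (h' u hu)⟩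

theorem Win.mono_steps {k k' : ℕ} {v : Fin n} {b p : ℕ} (h : G.Win k v b p) (hk : k ≤ k') :
    G.Win k' v b p := by
  induction hk with
  | refl => exact h
  | step _ ih => exact ih.succ

theorem Win.mono {k : ℕ} {v : Fin n} {b b' p p' : ℕ} (h : G.Win k v b p) (hb : b ≤ b')
    (hp : p ≤ p') : G.Win k v b' p' := by
  induction k generalizing v b b' p p' with
  | zero => exact ⟨h.1.trans_le hb, h.2⟩
  | succ k ih =>
    refine ⟨h.1.trans_le hb, h.2.imp_right ?_⟩
    rintro ⟨S, hS, q, hq, h'⟩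
    exact ⟨S, hS, q, hq.trans hp, fun u hu => ih (h' u hu) (Nat.sub_le_sub_right hb _) le_rfl⟩

/-- If `k` is the least number of steps needed to win, then `k` other vertices can be won in
fewer steps and within the same budget. -/
theorem exists_finset_of_least {k : ℕ} {v : Fin n} {b p : ℕ} (h : G.Win k v b p)
    (hk : ∀ j < k, ¬ G.Win j v b p) :
    ∃ A : Finset (Fin n), A.card = k ∧ ∀ x ∈ A, ∃ j < k, G.Win j x b p := by
  induction k generalizing v b p with
  | zero => exact ⟨∅, by simp⟩
  | succ k ih =>
    have ht : v ∉ G.target := fun ht => hk 0 (by omega) (win_of_mem_target ht 0 h.1 p)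
    obtain ⟨hb, h | ⟨S, hS, p', hp', hw⟩⟩ := h
    · exact absurd h ht
    -- If every kept successor could be won in fewer than `k` steps, then `v` could be won in `k`.
    -- So some `u` needs exactly `k` steps within what is left of the budget.
    obtain ⟨u, hu, hlt⟩ : ∃ u ∈ S, ∀ j < k, ¬ G.Win j u (b - G.weight v u) p' := by
      by_contra! hcon
      cases k with
      | zero =>
        obtain ⟨u, hu⟩ := hS.2.1
        obtain ⟨j, hj, -⟩ := hcon u hu
        omega
      | succ k =>
        refine hk (k + 1) (by omega) ⟨hb, Or.inr ⟨S, hS, p', hp', fun u hu => ?_⟩⟩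
        obtain ⟨j, hj, hj'⟩ := hcon u hu
        exact hj'.mono_steps (by omega)
    obtain ⟨A, hA, hA'⟩ := ih (hw u hu) hlt
    have hle : p' ≤ p := by omega
    -- The vertices of `A` are won in fewer than `k` steps within the very budget for which `u`
    -- needs `k`.
    have huA : u ∉ A := fun hmem => by
      obtain ⟨j, hj, hj'⟩ := hA' u hmem
      exact hlt j hj hj'
    refine ⟨insert u A, by rw [Finset.card_insert_of_notMem huA, hA], fun x hx => ?_⟩
    rw [Finset.mem_insert] at hx
    rcases hx with rfl | hx
    · exact ⟨k, by omega, (hw _ hu).mono (Nat.sub_le _ _) hle⟩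
    · obtain ⟨j, hj, hj'⟩ := hA' x hx
      exact ⟨j, by omega, hj'.mono (Nat.sub_le _ _) hle⟩

/-- A winning player needs no more steps than there are vertices. -/
theorem Win.card_steps {k : ℕ} {v : Fin n} {b p : ℕ} (h : G.Win k v b p) : G.Win n v b p := by
  classical
  have hex : ∃ k, G.Win k v b p := ⟨k, h⟩
  obtain ⟨A, hA, -⟩ := exists_finset_of_least (Nat.find_spec hex) fun j hj => Nat.find_min hex hj
  have := A.card_le_univ
  rw [Fintype.card_fin, hA] at this
  exact (Nat.find_spec hex).mono_steps this

/-- A budget of `W` per step is as good as an infinite one if no weight exceeds `W`. -/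
theorem Win.cap {W : ℕ} (hW : ∀ v, ∀ u ∈ G.succ v, G.weight v u ≤ W) {k : ℕ} {v : Fin n}
    {b p : ℕ} (h : G.Win k v b p) : G.Win k v (k * W + 1) p := by
  induction k generalizing v b p with
  | zero => exact ⟨by omega, h.2⟩
  | succ k ih =>
    refine ⟨by omega, h.2.imp_right ?_⟩
    rintro ⟨S, hS, q, hq, h'⟩
    refine ⟨S, hS, q, hq, fun u hu => (ih (h' u hu)).mono ?_ le_rfl⟩
    have := hW v u (hS.1 hu)
    rw [Nat.succ_mul]
    omega

end Game

/-! ## From winning to multi-strategies and back -/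

namespace MultiStrategy

variable {G : Game n} {v : Fin n}

/-- The multi-strategy that allows the moves to `S` first, and then proceeds according to the
multi-strategy given for the vertex reached. -/
def glue {S : Finset (Fin n)} (hS : G.Legal v S) (Θ : ∀ u, MultiStrategy G u) :
    MultiStrategy G v where
  choice
    | [] => ∅
    | [_] => S
    | _ :: u :: h => (Θ u).choice (u :: h)
  choice_nonempty h u hh hu h1 := by
    match h, hh, hu with
    | [_], _, _ => exact hS.2.1
    | _ :: u' :: h, hh, hu =>
      exact (Θ u').choice_nonempty _ u ⟨rfl, hh.2.tail⟩ (by simpa using hu) h1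
  choice_subset h u hh hu h1 := by
    match h, hh, hu with
    | [a], hh, hu =>
      have h2 := hh.1
      simp at h2 hu
      subst h2 hu
      exact hS.1
    | _ :: u' :: h, hh, hu =>
      exact (Θ u').choice_subset _ u ⟨rfl, hh.2.tail⟩ (by simpa using hu) h1

theorem allowed_glue_zero {S : Finset (Fin n)} (hS : G.Legal v S) (Θ : ∀ u, MultiStrategy G u)
    (ρ : ℕ → Fin n) : (glue hS Θ).allowed (playPrefix ρ 0) v = S := by
  rw [playPrefix_zero, allowed]
  split_ifs with h
  · rfl
  · exact (hS.2.2 h).symm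

theorem allowed_glue_succ {S : Finset (Fin n)} (hS : G.Legal v S) (Θ : ∀ u, MultiStrategy G u)
    (ρ : ℕ → Fin n) (k : ℕ) (u : Fin n) : (glue hS Θ).allowed (playPrefix ρ (k + 1)) u =
      (Θ (ρ 1)).allowed (playPrefix (fun i => ρ (i + 1)) k) u := by
  rw [playPrefix_succ_cons, allowed, allowed]
  cases k with
  | zero => simp [playPrefix_zero, glue]
  | succ k => simp [playPrefix_succ_cons, glue]

theorem prefixPenalty_glue {S : Finset (Fin n)} (hS : G.Legal v S) (Θ : ∀ u, MultiStrategy G u)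
    (ρ : ℕ → Fin n) (h0 : ρ 0 = v) (k : ℕ) : (glue hS Θ).prefixPenalty ρ (k + 1) =
      G.blocked v S + (Θ (ρ 1)).prefixPenalty (fun i => ρ (i + 1)) k := by
  induction k with
  | zero => rw [prefixPenalty_succ, h0, allowed_glue_zero]; simp [prefixPenalty]
  | succ k ih =>
    rw [prefixPenalty_succ, ih, prefixPenalty_succ, allowed_glue_succ, add_assoc]

end MultiStrategy

/-- The winning set is allowed first, then the multi-strategy of the successor reached takes over;
from the target on nothing is blocked, so the whole infinite play stays within the penalty
allowance. -/
theorem Game.Win.exists_multiStrategy {G : Game n} {k : ℕ} {v : Fin n} {b p : ℕ}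
    (h : G.Win k v b p) : ∃ Θ : MultiStrategy G v, ∀ ρ ∈ Θ.outcome,
      G.cost ρ < b ∧ ∀ k, Θ.prefixPenalty ρ k ≤ p := by
  classical
  by_cases ht : v ∈ G.target
  · refine ⟨MultiStrategy.full G v, fun ρ hρ => ⟨?_, fun k => ?_⟩⟩
    · rw [MultiStrategy.mem_outcome_iff] at hρ
      rw [Game.cost_of_mem_target (hρ.1 ▸ ht)]
      exact_mod_cast h.pos
    · rw [MultiStrategy.prefixPenalty_full]; exact Nat.zero_le _
  induction k generalizing v b p with
  | zero => exact absurd h.2 ht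
  | succ k ih =>
    obtain ⟨hb, h | ⟨S, hS, p', hp', hw⟩⟩ := h
    · exact absurd h ht
    have key : ∀ u, ∃ Θ : MultiStrategy G u, u ∈ S → ∀ ρ ∈ Θ.outcome,
        G.cost ρ < (b - G.weight v u : ℕ) ∧ ∀ k, Θ.prefixPenalty ρ k ≤ p' := by
      intro u
      by_cases hu : u ∈ S
      swap
      · exact ⟨MultiStrategy.full G u, fun h => absurd h hu⟩
      -- The induction hypothesis covers only vertices outside the target, so target successors are
      -- treated separately.
      by_cases hut : u ∈ G.target
      · refine ⟨MultiStrategy.full G u, fun _ ρ hρ => ⟨?_, fun k => ?_⟩⟩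
        · rw [MultiStrategy.mem_outcome_iff] at hρ
          rw [Game.cost_of_mem_target (hρ.1 ▸ hut)]
          exact_mod_cast (hw u hu).pos
        · rw [MultiStrategy.prefixPenalty_full]; exact Nat.zero_le _
      · obtain ⟨Θ, hΘ⟩ := ih (hw u hu) hut
        exact ⟨Θ, fun _ => hΘ⟩
    choose Θ hΘ using key
    refine ⟨MultiStrategy.glue hS Θ, fun ρ hρ => ?_⟩
    rw [MultiStrategy.mem_outcome_iff] at hρ
    obtain ⟨h0, hρ⟩ := hρ
    have h1 : ρ 1 ∈ S := by
      have := hρ 0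
      rwa [h0, MultiStrategy.allowed_glue_zero] at this
    have htail : (fun i => ρ (i + 1)) ∈ (Θ (ρ 1)).outcome := by
      rw [MultiStrategy.mem_outcome_iff]
      refine ⟨rfl, fun k => ?_⟩
      have := hρ (k + 1)
      rwa [MultiStrategy.allowed_glue_succ] at this
    obtain ⟨hc, hp⟩ := hΘ (ρ 1) h1 _ htail
    constructor
    · rw [Game.cost_of_notMem_target (h0 ▸ ht), h0]
      generalize G.cost (fun i => ρ (i + 1)) = c at hc
      induction c using ENat.recTopCoe with
      | top => simp at hc
      | coe c => norm_cast at hc ⊢; omega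
    · rintro (_ | k)
      · exact Nat.zero_le _
      · rw [MultiStrategy.prefixPenalty_glue hS Θ ρ h0]
        have := hp k
        omega

/-- A position during a play: the history, its last vertex, and the cost and the penalty
accumulated so far. -/
structure Position (n : ℕ) where
  hist : List (Fin n)
  last : Fin n
  cost : ℕ
  pen : ℕ

/-- The position after one more move, to `u`. -/
def MultiStrategy.move {G : Game n} {v : Fin n} (Θ : MultiStrategy G v) (s : Position n)
    (u : Fin n) : Position n :=
  ⟨s.hist ++ [u], u, s.cost + G.weight s.last u,
    s.pen + G.blocked s.last (Θ.allowed s.hist s.last)⟩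

/-- From a position that is not good and not in the target, some allowed move leads to a position
that is not good. Otherwise the finitely many successors have a common number of steps and a common
penalty allowance, which make the present position good. The implication inside the existential
provides an allowed move in every case, ready for a choice function. -/
theorem exists_move {G : Game n} {v : Fin n} (Θ : MultiStrategy G v) (b : ℕ) (y : ℕ∞)
    (s : Position n) (hh : G.IsHistory v s.hist) (hl : s.hist.getLast? = some s.last)
    (Good : Position n → Prop)
    (hGood : ∀ s, Good s ↔ ∃ k p', (s.pen + p' : ℕ) ≤ y ∧ G.Win k s.last (b - s.cost) p') :
    ∃ u ∈ Θ.allowed s.hist s.last, ¬ Good s → Good (Θ.move s u) → s.last ∈ G.target := by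
  have hleg := Θ.legal_allowed hh hl
  by_contra! hcon
  obtain ⟨u₀, hu₀⟩ := hleg.2.1
  obtain ⟨hs, -, ht⟩ := hcon u₀ hu₀
  apply hs
  have : ∀ u, ∃ k p', u ∈ Θ.allowed s.hist s.last →
      ((Θ.move s u).pen + p' : ℕ) ≤ y ∧ G.Win k u (b - (Θ.move s u).cost) p' := by
    intro u
    by_cases hu : u ∈ Θ.allowed s.hist s.last
    · obtain ⟨-, h, -⟩ := hcon u hu
      obtain ⟨k, p', h1, h2⟩ := (hGood _).1 h
      exact ⟨k, p', fun _ => ⟨h1, h2⟩⟩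
    · exact ⟨0, 0, fun h => absurd h hu⟩
  choose K P h using this
  obtain ⟨u₁, hu₁, hmax⟩ := Finset.exists_max_image _ P hleg.2.1
  rw [hGood]
  refine ⟨(Θ.allowed s.hist s.last).sup K + 1,
    G.blocked s.last (Θ.allowed s.hist s.last) + P u₁, ?_, ?_, Or.inr ?_⟩
  · have := (h u₁ hu₁).1
    rwa [MultiStrategy.move, add_assoc] at this
  · have := (h u₁ hu₁).2.pos
    simp only [MultiStrategy.move] at this
    omega
  · refine ⟨_, hleg, P u₁, le_rfl, fun u hu => ?_⟩
    have := (h u hu).2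
    simp only [MultiStrategy.move, ← Nat.sub_sub] at this
    exact (this.mono_steps (Finset.le_sup hu)).mono le_rfl (hmax u hu)

/-- A multi-strategy of finite worst cost can be turned into winning within bounded time. -/
theorem MultiStrategy.exists_win {G : Game n} {v : Fin n} (Θ : MultiStrategy G v) {c : ℕ}
    {y : ℕ∞} (hc : Θ.worstCost ≤ c) (hy : Θ.worstPenalty ≤ y) :
    ∃ k, ∃ p : ℕ, (p : ℕ∞) ≤ y ∧ G.Win k v (c + 1) p := by
  classical
  by_contra hbad
  let Good : Position n → Prop := fun s =>
    ∃ k p', (s.pen + p' : ℕ) ≤ y ∧ G.Win k s.last (c + 1 - s.cost) p'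
  have hnext : ∀ s : Position n, ∃ u, G.IsHistory v s.hist → s.hist.getLast? = some s.last →
      u ∈ Θ.allowed s.hist s.last ∧ (¬ Good s → Good (Θ.move s u) → s.last ∈ G.target) := by
    intro s
    by_cases h : G.IsHistory v s.hist ∧ s.hist.getLast? = some s.last
    · obtain ⟨u, h1, h2⟩ := exists_move Θ (c + 1) y s h.1 h.2 Good fun _ => Iff.rfl
      exact ⟨u, fun _ _ => ⟨h1, h2⟩⟩
    · exact ⟨v, fun h1 h2 => absurd ⟨h1, h2⟩ h⟩
  -- Following these moves yields a consistent play whose positions remain bad up to its first visit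
  -- of the target.
  choose next hnext using hnext
  let pos : ℕ → Position n := fun k =>
    Nat.rec ⟨[v], v, 0, 0⟩ (fun _ s => Θ.move s (next s)) k
  let ρ : ℕ → Fin n := fun k => (pos k).last
  have hhist : ∀ k, (pos k).hist = playPrefix ρ k := by
    intro k
    induction k with
    | zero => exact (playPrefix_zero ρ).symm
    | succ k ih => rw [playPrefix_succ, ← ih]; rfl
  have hlast : ∀ k, (pos k).hist.getLast? = some (pos k).last := fun k => by
    rw [hhist, getLast?_playPrefix]
  have hIsHist : ∀ k, G.IsHistory v (pos k).hist := by
    intro k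
    induction k with
    | zero => exact ⟨rfl, by simp [pos]⟩
    | succ k ih =>
      exact Game.isHistory_concat ih (hlast k)
        ((Θ.legal_allowed ih (hlast k)).1 (hnext (pos k) ih (hlast k)).1)
  have hmem : ρ ∈ Θ.outcome := by
    rw [mem_outcome_iff]
    refine ⟨rfl, fun k => ?_⟩
    rw [← hhist]
    exact (hnext (pos k) (hIsHist k) (hlast k)).1
  have hcost : ∀ k, (pos k).cost = ∑ i ∈ Finset.range k, G.weight (ρ i) (ρ (i + 1)) := by
    intro k
    induction k with
    | zero => rfl
    | succ k ih => rw [Finset.sum_range_succ, ← ih]; rfl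
  have hpen : ∀ k, (pos k).pen = Θ.prefixPenalty ρ k := by
    intro k
    induction k with
    | zero => rfl
    | succ k ih => rw [prefixPenalty_succ, ← ih, ← hhist]; rfl
  have hnotGood : ∀ k, (∀ j < k, ρ j ∉ G.target) → ¬ Good (pos k) := by
    intro k
    induction k with
    | zero =>
      rintro - ⟨k, p, h1, h2⟩
      exact hbad ⟨k, p, by simpa [pos] using h1, h2⟩
    | succ k ih =>
      intro hk hgood
      exact hk k (by omega) ((hnext (pos k) (hIsHist k) (hlast k)).2
        (ih fun j hj => hk j (by omega)) hgood)
  have hle := (Θ.worstCost_le_iff _).1 hc ρ hmem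
  by_cases hex : ∃ l, ρ l ∈ G.target
  · rw [Game.cost, dif_pos hex, Nat.cast_le] at hle
    -- On arrival at the target the position is won in `0` steps with allowance `0`: the cost so far
    -- is at most `c`, so budget is left, and the penalty so far is at most `y`.
    refine hnotGood (Nat.find hex) (fun j hj => Nat.find_min hex hj) ⟨0, 0, ?_, ?_, ?_⟩
    · rw [hpen]
      exact (Θ.worstPenalty_le_iff _).1 hy ρ hmem _
    · rw [hcost]
      have : ∑ i ∈ Finset.range (Nat.find hex), G.weight (ρ i) (ρ (i + 1)) ≤ c := by
        convert hle
      omega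
    · exact Nat.find_spec hex
  · rw [Game.cost, dif_neg hex] at hle
    simp at hle

namespace Game

variable {G : Game n} {v : Fin n}

theorem top_mem_ensured (y : ℕ∞) : ((⊤ : ℕ∞), y) ∈ G.ensured v := by
  refine ⟨MultiStrategy.full G v, le_top, ?_⟩
  refine (MultiStrategy.worstPenalty_le_iff _ _).2 fun ρ _ k => ?_
  simp [MultiStrategy.prefixPenalty_full]

/-- The allowance `p` is a natural number even when `y = ⊤`: an ensured finite cost can always be
ensured with finite penalty. -/
theorem coe_mem_ensured_iff (c : ℕ) (y : ℕ∞) :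
    ((c : ℕ∞), y) ∈ G.ensured v ↔ ∃ p : ℕ, (p : ℕ∞) ≤ y ∧ G.Win n v (c + 1) p := by
  constructor
  · rintro ⟨Θ, h1, h2⟩
    obtain ⟨k, p, hp, hw⟩ := Θ.exists_win h1 h2
    exact ⟨p, hp, hw.card_steps⟩
  · rintro ⟨p, hp, hw⟩
    obtain ⟨Θ, hΘ⟩ := hw.exists_multiStrategy
    refine ⟨Θ, (Θ.worstCost_le_iff _).2 fun ρ hρ => ?_,
      (Θ.worstPenalty_le_iff _).2 fun ρ hρ k => ?_⟩
    · exact Order.le_of_lt_add_one (by exact_mod_cast (hΘ ρ hρ).1)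
    · exact le_trans (by exact_mod_cast (hΘ ρ hρ).2 k) hp

end Game

/-! ## The least penalty for a given budget -/

/-- The least value of `a + (penalties of the blocked elements of l) + max mx (values of the
allowed elements of l)`; if `own = false` then no element may be blocked, and if `any = false` then
some element has to be allowed. -/
noncomputable def bestChoice {α : Type*} (val : α → ℕ∞) (pen : α → ℕ) (own : Bool) :
    List α → ℕ → ℕ∞ → Bool → ℕ∞
  | [], a, mx, any => if any then a + mx else ⊤
  | e :: l, a, mx, any =>
    if own then
      min (bestChoice val pen own l (a + pen e) mx any)
        (bestChoice val pen own l a (max mx (val e)) true)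
    else bestChoice val pen own l a (max mx (val e)) true

/-- Induction on the list, with `a`, `mx` and `any` as accumulators: sets containing the head
correspond to the branch that allows it, the others to the branch that blocks it. Without
repetitions, removing the head from a set does not affect the sum over the tail. Comparing with
natural `p` only keeps `∞` out of the arithmetic. -/
theorem bestChoice_le_iff {α : Type*} [DecidableEq α] (val : α → ℕ∞) (pen : α → ℕ) (own : Bool)
    (l : List α) (hl : l.Nodup) (a : ℕ) (mx : ℕ∞) (any : Bool) (p : ℕ) :
    bestChoice val pen own l a mx any ≤ p ↔ ∃ S ⊆ l.toFinset,
      (own = false → S = l.toFinset) ∧ (any = true ∨ S.Nonempty) ∧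
      ∃ p' : ℕ, a + (∑ u ∈ l.toFinset \ S, pen u) + p' ≤ p ∧ mx ≤ p' ∧ ∀ u ∈ S, val u ≤ p' := by
  induction l generalizing a mx any with
  | nil =>
    cases any
    · simp [bestChoice]
    · simp only [bestChoice, if_true]
      constructor
      · intro h
        induction mx using ENat.recTopCoe with
        | top => simp at h
        | coe m =>
          exact ⟨∅, by simp, by simp, by simp, m, by simpa using (by exact_mod_cast h), le_rfl,
            by simp⟩
      · rintro ⟨S, hS, -, -, p', h1, h2, -⟩
        simp at hS
        subst hS
        simp at h1
        exact le_trans (add_le_add_right h2 _) (by exact_mod_cast h1)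
  | cons e l ih =>
    obtain ⟨he, hl⟩ := List.nodup_cons.1 hl
    have heF : e ∉ l.toFinset := by simpa using he
    have allow : bestChoice val pen own l a (max mx (val e)) true ≤ p ↔
        ∃ S ⊆ (e :: l).toFinset, e ∈ S ∧ (own = false → S = (e :: l).toFinset) ∧
          ∃ p' : ℕ, a + (∑ u ∈ (e :: l).toFinset \ S, pen u) + p' ≤ p ∧ mx ≤ p' ∧
            ∀ u ∈ S, val u ≤ p' := by
      rw [ih hl]
      constructor
      · rintro ⟨S, hS, h1, -, p', h2, h3, h4⟩
        have heS : e ∉ S := fun h => heF (hS h)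
        refine ⟨insert e S, by rw [List.toFinset_cons]; exact Finset.insert_subset_insert _ hS,
          by simp, fun h => by rw [List.toFinset_cons, h1 h], p', ?_, (max_le_iff.1 h3).1, ?_⟩
        · rw [List.toFinset_cons, Finset.insert_sdiff_insert, Finset.sdiff_insert,
            Finset.erase_eq_of_notMem (by simp [heF])]
          exact h2
        · intro u hu
          rcases Finset.mem_insert.1 hu with rfl | hu
          exacts [(max_le_iff.1 h3).2, h4 u hu]
      · rintro ⟨S, hS, heS, h1, p', h2, h3, h4⟩
        rw [List.toFinset_cons] at hS h1 h2
        refine ⟨S.erase e, by rwa [← Finset.subset_insert_iff], fun h => ?_, Or.inl rfl, p', ?_,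
          max_le h3 (h4 e heS), fun u hu => h4 u (Finset.mem_of_mem_erase hu)⟩
        · rw [h1 h, Finset.erase_insert heF]
        · rw [Finset.insert_sdiff_of_mem _ heS] at h2
          have : l.toFinset \ S.erase e = l.toFinset \ S := by
            ext u
            simp only [Finset.mem_sdiff, Finset.mem_erase, not_and]
            exact ⟨fun h => ⟨h.1, h.2 fun hue => heF (hue ▸ h.1)⟩, fun h => ⟨h.1, fun _ => h.2⟩⟩
          rwa [this]
    have block : bestChoice val pen own l (a + pen e) mx any ≤ p ∧ own = true ↔
        ∃ S ⊆ (e :: l).toFinset, e ∉ S ∧ (own = false → S = (e :: l).toFinset) ∧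
          (any = true ∨ S.Nonempty) ∧
          ∃ p' : ℕ, a + (∑ u ∈ (e :: l).toFinset \ S, pen u) + p' ≤ p ∧ mx ≤ p' ∧
            ∀ u ∈ S, val u ≤ p' := by
      rw [ih hl, List.toFinset_cons]
      constructor
      · rintro ⟨⟨S, hS, h1, h0, p', h2, h3, h4⟩, ho⟩
        have heS : e ∉ S := fun h => heF (hS h)
        refine ⟨S, hS.trans (Finset.subset_insert _ _), heS, by simp [ho], h0, p', ?_, h3, h4⟩
        rw [Finset.insert_sdiff_of_notMem _ heS, Finset.sum_insert (by simp [heF])]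
        omega
      · rintro ⟨S, hS, heS, h1, h0, p', h2, h3, h4⟩
        have ho : own = true := by
          cases own
          · exact absurd (h1 rfl ▸ Finset.mem_insert_self e _) heS
          · rfl
        rw [Finset.insert_sdiff_of_notMem _ heS, Finset.sum_insert (by simp [heF])] at h2
        exact ⟨⟨S, (Finset.subset_insert_iff_of_notMem heS).1 hS, by simp [ho], h0, p',
          by omega, h3, h4⟩, ho⟩
    have : bestChoice val pen own (e :: l) a mx any ≤ p ↔
        (bestChoice val pen own l (a + pen e) mx any ≤ p ∧ own = true) ∨
          bestChoice val pen own l a (max mx (val e)) true ≤ p := by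
      cases own <;> simp [bestChoice]
    rw [this, allow, block]
    constructor
    · rintro (⟨S, h1, h2, h3, h4, h5⟩ | ⟨S, h1, h2, h3, h4⟩)
      · exact ⟨S, h1, h3, h4, h5⟩
      · exact ⟨S, h1, h3, Or.inr ⟨e, h2⟩, h4⟩
    · rintro ⟨S, h1, h3, h4, h5⟩
      by_cases h2 : e ∈ S
      · exact Or.inr ⟨S, h1, h2, h3, h5⟩
      · exact Or.inl ⟨S, h1, h2, h3, h4, h5⟩

namespace Game

/-- The successors of `v`, as a list. -/
def succList (G : Game n) (v : Fin n) : List (Fin n) :=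
  (List.finRange n).filter (· ∈ G.succ v)

theorem nodup_succList (G : Game n) (v : Fin n) : (G.succList v).Nodup :=
  (List.nodup_finRange n).filter _

theorem toFinset_succList (G : Game n) (v : Fin n) : (G.succList v).toFinset = G.succ v := by
  ext; simp [succList]

/-- The least penalty with which the target set can be reached from `v` in at most `k` steps with
cost less than `b`. -/
noncomputable def minPenalty (G : Game n) : ℕ → ℕ → Fin n → ℕ∞
  | 0, b, v => if b = 0 then ⊤ else if v ∈ G.target then 0 else ⊤
  | k + 1, b, v => if b = 0 then ⊤ else if v ∈ G.target then 0 else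
      bestChoice (fun u => G.minPenalty k (b - G.weight v u) u) (G.penalty v)
        (decide (v ∈ G.V₁)) (G.succList v) 0 0 false

theorem minPenalty_le_iff (G : Game n) (k b : ℕ) (v : Fin n) (p : ℕ) :
    G.minPenalty k b v ≤ p ↔ G.Win k v b p := by
  induction k generalizing b v p with
  | zero =>
    simp only [minPenalty, Win]
    split_ifs with h1 h2 <;> simp [Nat.pos_iff_ne_zero, *]
  | succ k ih =>
    simp only [minPenalty, Win]
    split_ifs with h1 h2
    · simp [h1]
    · simp [Nat.pos_iff_ne_zero, *]
    · simp only [bestChoice_le_iff _ _ _ _ (G.nodup_succList v), toFinset_succList, ih, h2,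
        Nat.pos_iff_ne_zero, Legal, blocked]
      simp only [decide_eq_false_iff_not, Bool.false_eq_true, false_or, zero_add, zero_le,
        true_and, ne_eq, h1, not_false_eq_true]
      constructor
      · rintro ⟨S, h3, h4, h5, p', h6, h7⟩
        exact ⟨S, ⟨h3, h5, h4⟩, p', h6, h7⟩
      · rintro ⟨S, ⟨h3, h5, h4⟩, p', h6, h7⟩
        exact ⟨S, h3, h4, h5, p', h6, h7⟩

theorem minPenalty_anti (G : Game n) (k : ℕ) (v : Fin n) :
    Antitone fun b => G.minPenalty k b v := by
  intro b b' h
  change G.minPenalty k b' v ≤ G.minPenalty k b v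
  generalize hx : G.minPenalty k b v = x
  induction x using ENat.recTopCoe with
  | top => exact le_top
  | coe p =>
    exact (G.minPenalty_le_iff k b' v p).2
      (((G.minPenalty_le_iff k b v p).1 hx.le).mono h le_rfl)

theorem minPenalty_zero (G : Game n) (k : ℕ) (v : Fin n) : G.minPenalty k 0 v = ⊤ := by
  cases k <;> simp [minPenalty]

theorem minPenalty_cap (G : Game n) {W : ℕ} (hW : ∀ v, ∀ u ∈ G.succ v, G.weight v u ≤ W)
    (k b : ℕ) (v : Fin n) : G.minPenalty k (k * W + 1) v ≤ G.minPenalty k b v := by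
  generalize hx : G.minPenalty k b v = x
  induction x using ENat.recTopCoe with
  | top => exact le_top
  | coe p =>
    exact (G.minPenalty_le_iff _ _ v p).2 (((G.minPenalty_le_iff k b v p).1 hx.le).cap hW)

/-! ### Pareto points as strict drops of the least penalty -/

theorem coe_mem_ensured_iff_minPenalty {G : Game n} {v : Fin n} (c : ℕ) (y : ℕ∞) :
    ((c : ℕ∞), y) ∈ G.ensured v ↔
      G.minPenalty n (c + 1) v < ⊤ ∧ G.minPenalty n (c + 1) v ≤ y := by
  rw [coe_mem_ensured_iff]
  constructor
  · rintro ⟨p, hp, hw⟩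
    rw [← minPenalty_le_iff] at hw
    exact ⟨hw.trans_lt (ENat.natCast_lt_top p), hw.trans hp⟩
  · rintro ⟨h1, h2⟩
    obtain ⟨p, hp⟩ := ENat.ne_top_iff_exists.1 h1.ne
    exact ⟨p, hp ▸ h2, (G.minPenalty_le_iff _ _ _ _).1 hp.ge⟩

theorem coe_mem_pareto_iff {G : Game n} {v : Fin n} (c : ℕ) (y : ℕ∞) :
    ((c : ℕ∞), y) ∈ G.pareto v ↔
      y = G.minPenalty n (c + 1) v ∧ G.minPenalty n (c + 1) v < G.minPenalty n c v := by
  constructor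
  · rintro ⟨h1, h2⟩
    have h3 := (coe_mem_ensured_iff_minPenalty _ _).1 h1
    have hy : y = G.minPenalty n (c + 1) v := by
      refine le_antisymm ?_ h3.2
      exact (h2 ((coe_mem_ensured_iff_minPenalty c _).2 ⟨h3.1, le_rfl⟩) ⟨le_rfl, h3.2⟩).2
    refine ⟨hy, lt_of_le_of_ne (G.minPenalty_anti n v (Nat.le_succ c)) fun heq => ?_⟩
    -- Without a drop at `c`, either `c = 0` and the least penalty is infinite, or the cost `c - 1`
    -- is ensured with the same penalty.
    cases c with
    | zero =>
      rw [minPenalty_zero] at heq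
      exact h3.1.ne heq
    | succ c =>
      have := (h2 ((coe_mem_ensured_iff_minPenalty c y).2 (heq ▸ h3))
        ⟨by simp, le_rfl⟩).1
      simp only [Nat.cast_le] at this
      omega
  · rintro ⟨rfl, h⟩
    refine ⟨(coe_mem_ensured_iff_minPenalty _ _).2 ⟨h.trans_le le_top, le_rfl⟩, ?_⟩
    rintro ⟨x, z⟩ hz ⟨hx1, hx2⟩
    obtain ⟨d, rfl⟩ := ENat.ne_top_iff_exists.1 (hx1.trans_lt (ENat.natCast_lt_top c)).ne
    have h3 := (coe_mem_ensured_iff_minPenalty _ _).1 hz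
    -- If `d < c`, the value at budget `c` is at most that at `d + 1`, hence at most that at `c +
    -- 1`, against the drop.
    have hdc : c = d := by
      by_contra hne
      simp only [Nat.cast_le] at hx1
      have := G.minPenalty_anti n v (show d + 1 ≤ c by omega)
      exact absurd (h.trans_le this) (not_lt.2 (h3.2.trans hx2))
    subst hdc
    exact ⟨le_rfl, h3.2⟩

/-- Infinite cost is always ensured with penalty `0`, so the point is dominated only if some finite
cost has penalty `0`; the budget `n * W + 1` decides this for all finite costs. -/
theorem top_mem_pareto_iff {G : Game n} {v : Fin n} {W : ℕ}
    (hW : ∀ v, ∀ u ∈ G.succ v, G.weight v u ≤ W) (y : ℕ∞) :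
    ((⊤ : ℕ∞), y) ∈ G.pareto v ↔ y = 0 ∧ 0 < G.minPenalty n (n * W + 1) v := by
  constructor
  · rintro ⟨h1, h2⟩
    have hy : y = 0 := le_antisymm (h2 (top_mem_ensured 0) ⟨le_rfl, zero_le⟩).2 zero_le
    refine ⟨hy, pos_iff_ne_zero.2 fun h0 => ?_⟩
    have := (h2 ((coe_mem_ensured_iff_minPenalty (n * W) y).2 (by simp [h0])) ⟨le_top, le_rfl⟩).1
    exact absurd this (not_le.2 (ENat.natCast_lt_top _))
  · rintro ⟨rfl, h⟩
    refine ⟨top_mem_ensured 0, ?_⟩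
    rintro ⟨x, z⟩ hz ⟨hx1, hx2⟩
    refine ⟨?_, zero_le⟩
    induction x using ENat.recTopCoe with
    | top => exact le_rfl
    | coe c =>
      have h3 := (coe_mem_ensured_iff_minPenalty _ _).1 hz
      exact absurd (h.trans_le ((G.minPenalty_cap hW n (c + 1) v).trans (h3.2.trans hx2)))
        (lt_irrefl _)

/-- The Pareto points of cost less than `b`, followed by `acc`. -/
noncomputable def paretoList (G : Game n) (v : Fin n) : ℕ → List (ℕ∞ × ℕ∞) → List (ℕ∞ × ℕ∞)
  | 0, acc => acc
  | b + 1, acc => G.paretoList v b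
      (if G.minPenalty n (b + 1) v < G.minPenalty n b v
        then ((b : ℕ∞), G.minPenalty n (b + 1) v) :: acc else acc)

theorem mem_paretoList_iff {G : Game n} {v : Fin n} (b : ℕ) (acc : List (ℕ∞ × ℕ∞))
    (x : ℕ∞ × ℕ∞) : x ∈ G.paretoList v b acc ↔ x ∈ acc ∨ (x.1 < b ∧ x ∈ G.pareto v) := by
  induction b generalizing acc with
  | zero => simp [paretoList]
  | succ b ih =>
    have hb : x.1 < (b + 1 : ℕ) ∧ x ∈ G.pareto v ↔
        (x = ((b : ℕ∞), G.minPenalty n (b + 1) v) ∧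
          G.minPenalty n (b + 1) v < G.minPenalty n b v) ∨ (x.1 < b ∧ x ∈ G.pareto v) := by
      obtain ⟨x, y⟩ := x
      induction x using ENat.recTopCoe with
      | top => simp
      | coe c =>
        simp only [coe_mem_pareto_iff, Nat.cast_lt, Prod.mk.injEq, Nat.cast_inj,
          Nat.lt_succ_iff_lt_or_eq]
        constructor
        · rintro ⟨h | rfl, h1, h2⟩
          · exact Or.inr ⟨h, h1, h2⟩
          · exact Or.inl ⟨⟨rfl, h1⟩, h2⟩
        · rintro (⟨⟨rfl, h1⟩, h2⟩ | ⟨h, h1, h2⟩)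
          · exact ⟨Or.inr rfl, h1, h2⟩
          · exact ⟨Or.inl h, h1, h2⟩
    rw [paretoList, ih, hb]
    split_ifs with h <;> simp [h]
    tauto

/-- Costs are tried in decreasing order, so each new point is cheaper than everything accumulated.
-/
theorem nodup_paretoList {G : Game n} {v : Fin n} (b : ℕ) (acc : List (ℕ∞ × ℕ∞))
    (hacc : acc.Nodup) (hb : ∀ x ∈ acc, (b : ℕ∞) ≤ x.1) : (G.paretoList v b acc).Nodup := by
  induction b generalizing acc with
  | zero => exact hacc
  | succ b ih =>
    have hle : (b : ℕ∞) < (b + 1 : ℕ) := by exact_mod_cast Nat.lt_succ_self b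
    rw [paretoList]
    split_ifs
    · refine ih _ (List.nodup_cons.2 ⟨fun h => ?_, hacc⟩) ?_
      · exact absurd (hb _ h) (not_le.2 hle)
      · intro x hx
        rcases List.mem_cons.1 hx with rfl | hx
        exacts [le_rfl, hle.le.trans (hb x hx)]
    · exact ih _ hacc fun x hx => hle.le.trans (hb x hx)

/-- The Pareto frontier, as a list; `b` is one more than a bound on the costs to be tried. -/
noncomputable def frontier (G : Game n) (v : Fin n) (b : ℕ) : List (ℕ∞ × ℕ∞) :=
  G.paretoList v b (if 0 < G.minPenalty n b v then [(⊤, 0)] else [])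

theorem nodup_frontier (G : Game n) (v : Fin n) (b : ℕ) : (G.frontier v b).Nodup := by
  refine nodup_paretoList _ _ ?_ ?_ <;> split_ifs <;> simp

theorem mem_frontier_iff {G : Game n} {v : Fin n} {W : ℕ}
    (hW : ∀ v, ∀ u ∈ G.succ v, G.weight v u ≤ W) (x : ℕ∞ × ℕ∞) :
    x ∈ G.frontier v (n * W + 1) ↔ x ∈ G.pareto v := by
  obtain ⟨x, y⟩ := x
  rw [frontier, mem_paretoList_iff]
  induction x using ENat.recTopCoe with
  | top =>
    rw [top_mem_pareto_iff hW]
    split_ifs with h <;> simp [h]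
  | coe c =>
    have : ((c : ℕ∞), y) ∉ (if 0 < G.minPenalty n (n * W + 1) v then [((⊤ : ℕ∞), (0 : ℕ∞))]
        else []) := by
      split_ifs <;> simp
    simp only [this, false_or, and_iff_right_iff_imp, coe_mem_pareto_iff]
    rintro ⟨-, h⟩
    -- No drop occurs beyond the budget `n * W + 1`, where the least penalty has reached its
    -- minimum.
    by_contra hc
    simp only [Nat.cast_lt, not_lt] at hc
    exact absurd (h.trans_le ((G.minPenalty_anti n v hc).trans
      (G.minPenalty_cap hW n (c + 1) v))) (lt_irrefl _)

end Game

/-! ## Evaluating programs -/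

/-- `e` evaluates on `x` to `y` in at most `T` steps. -/
def Run (P : Program) (e : Code) (x y : Data) (T : ℕ) : Prop :=
  ∃ t ≤ T, Exec P e x y t

namespace Code

/-- The number of nodes of an expression. -/
def length : Code → ℕ
  | arg => 1
  | const _ => 1
  | fst e => e.length + 1
  | snd e => e.length + 1
  | pair e f => e.length + f.length + 1
  | isPair e => e.length + 1
  | add e f => e.length + f.length + 1
  | sub e f => e.length + f.length + 1
  | ite c e f => c.length + e.length + f.length + 1
  | comp f e => f.length + e.length + 1
  | call _ e => e.length + 1

/-- Whether an expression contains no call. -/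
def callFree : Code → Bool
  | arg => true
  | const _ => true
  | fst e => e.callFree
  | snd e => e.callFree
  | pair e f => e.callFree && f.callFree
  | isPair e => e.callFree
  | add e f => e.callFree && f.callFree
  | sub e f => e.callFree && f.callFree
  | ite c e f => c.callFree && e.callFree && f.callFree
  | comp f e => f.callFree && e.callFree
  | call _ _ => false

/-- The value of a call-free expression. -/
def eval : Code → Data → Data
  | arg, x => x
  | const k, _ => .nat k
  | fst e, x => (e.eval x).fst
  | snd e, x => (e.eval x).snd
  | pair e f, x => .pair (e.eval x) (f.eval x)
  | isPair e, x => .nat (e.eval x).isPair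
  | add e f, x => .nat ((e.eval x).val + (f.eval x).val)
  | sub e f, x => .nat ((e.eval x).val - (f.eval x).val)
  | ite c e f, x => if (c.eval x).val ≠ 0 then e.eval x else f.eval x
  | comp f e, x => f.eval (e.eval x)
  | call _ _, x => x

end Code

namespace Run

variable {P : Program} {x y z b : Data} {c e f : Code} {s t : ℕ}

theorem mono (h : Run P e x y s) (hst : s ≤ t) : Run P e x y t :=
  let ⟨r, hr, h⟩ := h; ⟨r, hr.trans hst, h⟩

theorem pair (he : Run P e x y s) (hf : Run P f x z t) :
    Run P (.pair e f) x (.pair y z) (s + t + 1) :=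
  let ⟨a, ha, he⟩ := he; let ⟨b, hb, hf⟩ := hf; ⟨a + b + 1, by omega, he.pair hf⟩

theorem add (he : Run P e x y s) (hf : Run P f x z t) :
    Run P (.add e f) x (.nat (y.val + z.val)) (s + t + 1) :=
  let ⟨a, ha, he⟩ := he; let ⟨b, hb, hf⟩ := hf; ⟨a + b + 1, by omega, he.add hf⟩

theorem ite_true (hc : Run P c x b s) (hb : b.val ≠ 0) (he : Run P e x y t) :
    Run P (.ite c e f) x y (s + t + 1) :=
  let ⟨a, ha, hc⟩ := hc; let ⟨b, hb', he⟩ := he; ⟨a + b + 1, by omega, .ite_true hc hb he⟩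

theorem ite_false (hc : Run P c x b s) (hb : b.val = 0) (hf : Run P f x y t) :
    Run P (.ite c e f) x y (s + t + 1) :=
  let ⟨a, ha, hc⟩ := hc; let ⟨b, hb', hf⟩ := hf; ⟨a + b + 1, by omega, .ite_false hc hb hf⟩

theorem comp (he : Run P e x y s) (hf : Run P f y z t) : Run P (.comp f e) x z (s + t + 1) :=
  let ⟨a, ha, he⟩ := he; let ⟨b, hb, hf⟩ := hf; ⟨a + b + 1, by omega, he.comp hf⟩

theorem call {i : ℕ} {body : Code} (he : Run P e x y s) (hi : P[i]? = some body)
    (hf : Run P body y z t) : Run P (.call i e) x z (s + t + 1) :=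
  let ⟨a, ha, he⟩ := he; let ⟨b, hb, hf⟩ := hf; ⟨a + b + 1, by omega, he.call hi hf⟩

theorem of_callFree (P : Program) {e : Code} (he : e.callFree = true) (x : Data) :
    Run P e x (e.eval x) e.length := by
  induction e generalizing x with
  | arg => exact ⟨1, le_rfl, .arg⟩
  | const k => exact ⟨1, le_rfl, .const⟩
  | fst e ih => obtain ⟨t, ht, h⟩ := ih he x; exact ⟨t + 1, by simpa [Code.length], h.fst⟩
  | snd e ih => obtain ⟨t, ht, h⟩ := ih he x; exact ⟨t + 1, by simpa [Code.length], h.snd⟩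
  | isPair e ih => obtain ⟨t, ht, h⟩ := ih he x; exact ⟨t + 1, by simpa [Code.length], h.isPair⟩
  | pair e f ihe ihf =>
    simp only [Code.callFree, Bool.and_eq_true] at he
    exact (ihe he.1 x).pair (ihf he.2 x)
  | add e f ihe ihf =>
    simp only [Code.callFree, Bool.and_eq_true] at he
    exact (ihe he.1 x).add (ihf he.2 x)
  | sub e f ihe ihf =>
    simp only [Code.callFree, Bool.and_eq_true] at he
    obtain ⟨s, hs, h1⟩ := ihe he.1 x
    obtain ⟨t, ht, h2⟩ := ihf he.2 x
    exact ⟨s + t + 1, by simp only [Code.length]; omega, h1.sub h2⟩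
  | ite c e f ihc ihe ihf =>
    simp only [Code.callFree, Bool.and_eq_true] at he
    simp only [Code.eval]
    split_ifs with h
    · exact ((ihc he.1.1 x).ite_true h (ihe he.1.2 x)).mono (by simp only [Code.length]; omega)
    · exact ((ihc he.1.1 x).ite_false (not_not.1 h) (ihf he.2 x)).mono
        (by simp only [Code.length]; omega)
  | comp f e ihf ihe =>
    simp only [Code.callFree, Bool.and_eq_true] at he
    exact ((ihe he.2 x).comp (ihf he.1 _)).mono (by simp only [Code.length]; omega)
  | call i e => simp [Code.callFree] at he

/-- A call-free expression takes at most as many steps as it has nodes, whatever the data. The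
uniform bound `100` fits every call-free piece of the program, so that such pieces are mostly
discharged by `rfl`. -/
theorem basic (h : e.eval x = y) (he : e.callFree = true := by rfl)
    (hl : e.length ≤ 100 := by decide) : Run P e x y 100 :=
  h ▸ (of_callFree P he x).mono hl

end Run

/-! ## The program -/

namespace Code

/-- `∞`, as a datum. -/
def infinity : Code := pair (const 0) (const 0)

/-- On a pair of extended natural numbers: nonzero iff the first one is the smaller one. -/
def less : Code := ite (isPair (fst arg)) (const 0) (ite (isPair (snd arg)) (const 1)
  (sub (snd arg) (fst arg)))

/-- The minimum of a pair of extended natural numbers. -/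
def minimum : Code := ite less (fst arg) (snd arg)

/-- The maximum of a pair of extended natural numbers. -/
def maximum : Code := ite less (snd arg) (fst arg)

/-- On `(l, i)`: the `i`-th element of the list `l`. -/
def nthBody : Code := ite (snd arg) (call 1 (pair (snd (fst arg)) (sub (snd arg) (const 1))))
  (fst (fst arg))

/-- The sum of all atoms of a datum. -/
def sumBody : Code := ite (isPair arg) (add (call 2 (fst arg)) (call 2 (snd arg))) arg

/-- On `(l, k)`: the length of the list `l` times `k`. -/
def mulBody : Code := ite (isPair (fst arg))
  (add (snd arg) (call 3 (pair (snd (fst arg)) (snd arg)))) (const 0)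

/-- The continuation of `minPenaltyBody`, on `(data of v, (fuel, (b, (v, vertices))))`. -/
def minPenaltyRest : Code := ite (fst (snd (fst arg))) (const 0)
  (ite (isPair (fst (snd arg)))
    (call 5 (pair (snd (snd (fst arg))) (pair (fst (fst arg)) (pair (const 0) (pair (const 0)
      (pair (const 0) (pair (snd (fst (snd arg)))
        (pair (fst (snd (snd arg))) (snd (snd (snd (snd arg))))))))))))
    infinity)

/-- On `(fuel, (b, (v, vertices)))`, where `fuel` is a list of length `k`: the value of
`Game.minPenalty` at `k`, `b` and `v`. -/
def minPenaltyBody : Code := ite (fst (snd arg))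
  (comp minPenaltyRest
    (pair (call 1 (pair (snd (snd (snd arg))) (fst (snd (snd arg))))) arg))
  infinity

/-- The argument of the recursive call of `bestChoiceBody` that allows the first edge. -/
def allowArg : Code := pair (snd (fst (snd arg))) (pair (fst (snd (snd arg)))
  (pair (fst (snd (snd (snd arg)))) (pair (comp maximum (pair (fst (snd (snd (snd (snd arg)))))
    (fst arg))) (pair (const 1) (snd (snd (snd (snd (snd (snd arg))))))))))

/-- The argument of the recursive call of `bestChoiceBody` that blocks the first edge. -/
def blockArg : Code := pair (snd (fst (snd arg))) (pair (fst (snd (snd arg)))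
  (pair (add (fst (snd (snd (snd arg)))) (snd (snd (fst (fst (snd arg))))))
    (snd (snd (snd (snd arg))))))

/-- The continuation of `bestChoiceBody`, on `(value of the first edge, argument)`. -/
def bestChoiceRest : Code := ite (fst (snd (snd arg)))
  (comp minimum (pair (call 5 blockArg) (call 5 allowArg))) (call 5 allowArg)

/-- On `(edges, (own, (a, (mx, (any, (fuel, (b, vertices)))))))`: the value of `bestChoice`. -/
def bestChoiceBody : Code := ite (isPair (fst arg))
  (comp bestChoiceRest (pair
    (call 4 (pair (fst (snd (snd (snd (snd (snd arg))))))
      (pair (sub (fst (snd (snd (snd (snd (snd (snd arg))))))) (fst (snd (fst (fst arg)))))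
        (pair (fst (fst (fst arg))) (snd (snd (snd (snd (snd (snd (snd arg)))))))))))
    arg))
  (ite (fst (snd (snd (snd (snd arg)))))
    (ite (isPair (fst (snd (snd (snd arg))))) (fst (snd (snd (snd arg))))
      (add (fst (snd (snd arg))) (fst (snd (snd (snd arg))))))
    infinity)

/-- On `(g, (g', (b, acc)))`: adds the pair `(b - 1, g)` to the list `acc` if `g < g'`. -/
def extend : Code := ite (comp less (pair (fst arg) (fst (snd arg))))
  (pair (pair (sub (fst (snd (snd arg))) (const 1)) (fst arg)) (snd (snd (snd arg))))
  (snd (snd (snd arg)))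

/-- On `(b, (acc, (v₀, vertices)))`: the value of `Game.paretoList`. -/
def paretoListBody : Code := ite (fst arg)
  (call 6 (pair (sub (fst arg) (const 1)) (pair
    (comp extend (pair
      (call 4 (pair (snd (snd (snd arg))) (pair (fst arg) (snd (snd arg)))))
      (pair
        (call 4 (pair (snd (snd (snd arg))) (pair (sub (fst arg) (const 1)) (snd (snd arg)))))
        (pair (fst arg) (fst (snd arg))))))
    (snd (snd arg)))))
  (fst (snd arg))

/-- The list to which the Pareto points of finite cost are added; the argument is the least
penalty for finite cost. -/
def start : Code := ite (comp less (pair (const 0) arg))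
  (pair (pair infinity (const 0)) (const 0)) (const 0)

/-- The continuation of `frontierBody`, on `(b, (v₀, vertices))`. -/
def frontierRest : Code := call 6 (pair (fst arg) (pair
  (comp start (call 4 (pair (snd (snd arg)) arg))) (snd arg)))

/-- On `(v₀, vertices)`: the Pareto frontier. -/
def frontierBody : Code := comp frontierRest
  (pair (add (const 1) (call 3 (pair (snd arg) (call 2 arg)))) arg)

end Code

/-- The program that computes the Pareto frontier. -/
def frontierProgram : Program :=
  [.frontierBody, .nthBody, .sumBody, .mulBody, .minPenaltyBody, .bestChoiceBody,
    .paretoListBody]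

/-! ## Correctness and running time -/

theorem enatData_top : enatData ⊤ = .pair (.nat 0) (.nat 0) := by simp [enatData]

theorem enatData_coe (k : ℕ) : enatData k = .nat k := by simp [enatData]

namespace Code

theorem eval_less (a b : ℕ∞) :
    (less.eval (.pair (enatData a) (enatData b))).val ≠ 0 ↔ a < b := by
  induction a using ENat.recTopCoe <;> induction b using ENat.recTopCoe <;>
    simp [less, eval, enatData_top, enatData_coe, Data.fst, Data.snd, Data.isPair, Data.val,
      Nat.sub_eq_zero_iff_le]

theorem eval_minimum (a b : ℕ∞) :
    minimum.eval (.pair (enatData a) (enatData b)) = enatData (min a b) := by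
  rw [minimum, eval]
  split_ifs with h
  · rw [min_eq_left ((eval_less a b).1 h).le]; rfl
  · rw [min_eq_right (not_lt.1 fun h' => h ((eval_less a b).2 h'))]; rfl

theorem eval_maximum (a b : ℕ∞) :
    maximum.eval (.pair (enatData a) (enatData b)) = enatData (max a b) := by
  rw [maximum, eval]
  split_ifs with h
  · rw [max_eq_right ((eval_less a b).1 h).le]; rfl
  · rw [max_eq_left (not_lt.1 fun h' => h ((eval_less a b).2 h'))]; rfl

end Code

theorem run_nth (l : List Data) (i : ℕ) (hi : i < l.length) :
    Run frontierProgram .nthBody (.pair (Data.ofList l) (.nat i)) l[i] (400 * (i + 1)) := by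
  induction l generalizing i with
  | nil => simp at hi
  | cons a l ih =>
    cases i with
    | zero =>
      exact .mono (.ite_false (.basic rfl) (by rfl) (.basic rfl)) (by omega)
    | succ i =>
      exact .mono (.ite_true (.basic rfl) (by exact Nat.succ_ne_zero i)
        (.call (.basic rfl) (by rfl) (ih i (by simpa using hi)))) (by omega)

/-- The sum of all atoms of a datum. -/
def Data.sum : Data → ℕ
  | nat k => k
  | pair a b => a.sum + b.sum

theorem run_sum (d : Data) : Run frontierProgram .sumBody d (.nat d.sum) (600 * d.size) := by
  induction d with
  | nat k =>
    exact .mono (.ite_false (.basic rfl) (by rfl) (.basic rfl)) (by simp only [Data.size]; omega)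
  | pair a b iha ihb =>
    exact .mono (.ite_true (.basic rfl) (by exact Nat.one_ne_zero)
      (.add (y := .nat a.sum) (z := .nat b.sum) (.call (.basic rfl) (by rfl) iha)
        (.call (.basic rfl) (by rfl) ihb)))
        (by simp only [Data.size]; omega)

theorem run_mul (l : List Data) (k : ℕ) :
    Run frontierProgram .mulBody (.pair (Data.ofList l) (.nat k)) (.nat (l.length * k))
      (600 * (l.length + 1)) := by
  induction l with
  | nil =>
    exact .mono (.ite_false (.basic rfl) (by rfl) (.basic (by simp [Code.eval]))) (by simp)
  | cons a l ih =>
    have h : l.length * k + k = k + l.length * k := add_comm _ _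
    rw [List.length_cons, Nat.succ_mul, h]
    exact .mono (.ite_true (.basic rfl) (by exact Nat.one_ne_zero)
      (.add (y := .nat k) (z := .nat (l.length * k)) (.basic rfl)
        (.call (.basic rfl) (by rfl) ih))) (by omega)

/-- The vertices of a game, as a datum. -/
def Game.verticesData (G : Game n) : Data :=
  .ofList ((List.finRange n).map G.vertexData)

/-- With the flags written through `Bool.toNat`, the vertex matches the arguments of the program
definitionally. -/
theorem Game.vertexData_eq (G : Game n) (v : Fin n) : G.vertexData v =
    .pair (.nat (decide (v ∈ G.V₁)).toNat) (.pair (.nat (decide (v ∈ G.target)).toNat)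
      (.ofList ((G.succList v).map (G.edgeData v)))) := by
  by_cases h1 : v ∈ G.V₁ <;> by_cases h2 : v ∈ G.target <;>
    simp [vertexData, succList, h1, h2]

/-- A bound on the time to evaluate `bestChoice` on a list, where `C` bounds the time spent on
each element. -/
def choiceTime (C : ℕ) : ℕ → ℕ
  | 0 => C
  | l + 1 => 2 * choiceTime C l + C

/-- A bound on the time to evaluate `Game.minPenalty` on a game with `n` vertices. -/
def penaltyTime (n : ℕ) : ℕ → ℕ
  | 0 => 1000 * (n + 1)
  | k + 1 => 1000 * (n + 1) + choiceTime (penaltyTime n k + 2000) n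

theorem choiceTime_mono (C : ℕ) : Monotone (choiceTime C) :=
  monotone_nat_of_le_succ fun l => by simp only [choiceTime]; omega

/-- Adding `C` on the left makes the quantity double exactly at each element. -/
theorem choiceTime_add_le (C l : ℕ) : choiceTime C l + C ≤ 2 ^ (l + 1) * C := by
  induction l with
  | zero => simp only [choiceTime]; omega
  | succ l ih =>
    rw [pow_succ, choiceTime]
    nlinarith

/-- Each level multiplies the bound by at most `2 ^ (n + 1) + 1`: the enumeration of subsets gives
`2 ^ (n + 1)`, and the additive overhead is absorbed by one more copy. -/
theorem penaltyTime_add_le (n k : ℕ) :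
    penaltyTime n k + 2000 ≤ 2 ^ ((2 * n + 12) * (k + 1)) := by
  have h1 : 3000 * (n + 1) ≤ 2 ^ (n + 12) := by
    have := Nat.lt_two_pow_self (n := n)
    rw [pow_add]
    omega
  have h2 : 2 ^ (n + 12) ≤ 2 ^ (2 * n + 12) := Nat.pow_le_pow_right (by omega) (by omega)
  induction k with
  | zero => simp only [penaltyTime, zero_add, mul_one]; omega
  | succ k ih =>
    have h3 := (choiceTime_add_le (penaltyTime n k + 2000) n).trans (Nat.mul_le_mul_left _ ih)
    have h5 : 2 ^ (2 * n + 12) ≤ 2 ^ ((2 * n + 12) * (k + 1)) :=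
      Nat.pow_le_pow_right (by omega) (Nat.le_mul_of_pos_right _ (by omega))
    have h6 : (2 ^ (n + 1) + 1) * 2 ^ ((2 * n + 12) * (k + 1)) ≤
        2 ^ ((2 * n + 12) * (k + 1 + 1)) := by
      rw [Nat.mul_succ _ (k + 1), pow_add _ _ (2 * n + 12), mul_comm]
      refine Nat.mul_le_mul_left _ ?_
      have : 2 ^ (n + 1) * 2 ≤ 2 ^ (2 * n + 12) := by
        rw [← pow_succ]; exact Nat.pow_le_pow_right (by omega) (by omega)
      have := Nat.one_le_two_pow (n := n + 1)
      omega
    rw [Nat.add_mul] at h6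
    simp only [penaltyTime]
    have h7 := h1.trans (h2.trans h5)
    linarith

/-- The argument of `Code.minPenaltyBody`. -/
def Game.penaltyArg (G : Game n) (fuel : List Data) (b : ℕ) (v : Fin n) : Data :=
  .pair (.ofList fuel) (.pair (.nat b) (.pair (.nat v) G.verticesData))

/-- The argument of `Code.bestChoiceBody`. -/
noncomputable def Game.choiceArg (G : Game n) (v : Fin n) (own : Bool) (fuel : List Data) (b : ℕ)
    (l : List (Fin n)) (a : ℕ) (mx : ℕ∞) (any : Bool) : Data :=
  .pair (.ofList (l.map (G.edgeData v))) (.pair (.nat own.toNat) (.pair (.nat a)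
    (.pair (enatData mx) (.pair (.nat any.toNat) (.pair (.ofList fuel)
      (.pair (.nat b) G.verticesData))))))

theorem Code.eval_allowArg (G : Game n) (v : Fin n) (own : Bool) (fuel : List Data) (b : ℕ)
    (u : Fin n) (l : List (Fin n)) (a : ℕ) (mx : ℕ∞) (any : Bool) (x : ℕ∞) :
    allowArg.eval (.pair (enatData x) (G.choiceArg v own fuel b (u :: l) a mx any)) =
      G.choiceArg v own fuel b l a (max mx x) true := by
  rw [Game.choiceArg, Game.choiceArg, ← Code.eval_maximum]
  rfl

/-- The mutual recursion is untangled by assuming the values for the smaller fuel, at all budgets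
and vertices, within time `T`; what remains is an induction on the list of edges. -/
theorem run_bestChoice {G : Game n} {k T : ℕ} {fuel : List Data}
    (hT : ∀ b u, Run frontierProgram .minPenaltyBody (G.penaltyArg fuel b u)
      (enatData (G.minPenalty k b u)) T)
    (v : Fin n) (own : Bool) (b : ℕ) (l : List (Fin n)) (a : ℕ) (mx : ℕ∞) (any : Bool) :
    Run frontierProgram .bestChoiceBody (G.choiceArg v own fuel b l a mx any)
      (enatData (bestChoice (fun u => G.minPenalty k (b - G.weight v u) u) (G.penalty v) own
        l a mx any)) (choiceTime (T + 2000) l.length) := by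
  induction l generalizing a mx any with
  | nil =>
    refine .mono (.ite_false (.basic rfl) (by rfl) (.basic (y := enatData _) ?_))
      (t := choiceTime (T + 2000) 0) (by simp only [choiceTime]; omega)
    cases any
    · simp [bestChoice, enatData_top, Code.eval, Game.choiceArg, Code.infinity, Data.fst,
        Data.snd, Data.val]
    · induction mx using ENat.recTopCoe with
      | top => simp [bestChoice, enatData_top, Code.eval, Game.choiceArg, Data.fst,
          Data.snd, Data.val, Data.isPair]
      | coe m =>
        have : enatData ((a : ℕ∞) + m) = .nat (a + m) := by exact_mod_cast enatData_coe (a + m)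
        simp [bestChoice, enatData_coe, Code.eval, Game.choiceArg, Data.fst,
          Data.snd, Data.val, Data.isPair, this]
  | cons u l ih =>
    have hval := hT (b - G.weight v u) u
    have hallow := ih a (max mx (G.minPenalty k (b - G.weight v u) u)) true
    have hblock := ih (a + G.penalty v u) mx any
    set x := G.minPenalty k (b - G.weight v u) u
    have hallow' : Run frontierProgram (.call 5 .allowArg)
        (.pair (enatData x) (G.choiceArg v own fuel b (u :: l) a mx any)) _ _ :=
      Run.call (.basic (Code.eval_allowArg G v own fuel b u l a mx any x)) rfl hallow
    refine .mono (.ite_true (.basic rfl) (by exact Nat.one_ne_zero) (.comp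
      (.pair (.call (.basic rfl) (by rfl) hval) (.basic rfl)) (?_ : Run _ _ _ _
        (2 * choiceTime (T + 2000) l.length + 1000))))
      (by simp only [choiceTime, List.length_cons]; omega)
    cases own with
    | false => exact .mono (.ite_false (.basic rfl) (by rfl) hallow') (by omega)
    | true =>
      exact .mono (.ite_true (.basic rfl) (by exact Nat.one_ne_zero)
        (.comp (.pair (.call (.basic rfl) (by rfl) hblock) hallow')
          (.basic (Code.eval_minimum _ _)))) (by omega)

theorem Game.length_succList_le (G : Game n) (v : Fin n) : (G.succList v).length ≤ n :=
  (List.length_filter_le _ _).trans (by simp)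

theorem run_nth_vertex (G : Game n) (v : Fin n) :
    Run frontierProgram .nthBody (.pair G.verticesData (.nat v)) (G.vertexData v)
      (400 * n) := by
  have h := run_nth ((List.finRange n).map G.vertexData) v (by simp)
  have h2 : ((List.finRange n).map G.vertexData)[(v : ℕ)]'(by simp) = G.vertexData v := by simp
  rw [h2] at h
  exact h.mono (by have := v.isLt; omega)

theorem eval_isTarget (G : Game n) (v : Fin n) (x : Data) :
    (Code.eval (.fst (.snd (.fst .arg))) (.pair (G.vertexData v) x)).val =
      (decide (v ∈ G.target)).toNat := by
  rw [Game.vertexData_eq]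
  rfl

/-- The cases of budget `0` and of a target vertex do not depend on the fuel and are settled here
once. -/
theorem run_minPenaltyBody {G : Game n} {fuel : List Data} {k b : ℕ} {v : Fin n} {T : ℕ}
    (hT : 500 ≤ T) (h : b ≠ 0 → v ∉ G.target → Run frontierProgram .minPenaltyRest
      (.pair (G.vertexData v) (G.penaltyArg fuel b v)) (enatData (G.minPenalty k b v)) T) :
    Run frontierProgram .minPenaltyBody (G.penaltyArg fuel b v)
      (enatData (G.minPenalty k b v)) (T + 400 * n + 500) := by
  by_cases hb : b = 0
  · subst hb
    rw [Game.minPenalty_zero, enatData_top]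
    exact .mono (.ite_false (.basic rfl) (by rfl) (.basic rfl)) (by omega)
  have hrest : Run frontierProgram .minPenaltyRest
      (.pair (G.vertexData v) (G.penaltyArg fuel b v)) (enatData (G.minPenalty k b v)) T := by
    by_cases ht : v ∈ G.target
    · have h0 : G.minPenalty k b v = (0 : ℕ) := by
        cases k <;> simp [Game.minPenalty, ht, hb]
      rw [h0, enatData_coe]
      exact .mono (.ite_true (.basic rfl) (by rw [eval_isTarget]; simp [ht]) (.basic rfl))
        (by omega)
    · exact h hb ht
  exact .mono (.ite_true (.basic rfl) (by exact hb) (.comp (.pair (.call (.basic rfl) (by rfl)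
    (run_nth_vertex G v)) (.basic rfl)) hrest)) (by omega)

theorem run_minPenalty (G : Game n) (fuel : List Data) (b : ℕ) (v : Fin n) :
    Run frontierProgram .minPenaltyBody (G.penaltyArg fuel b v)
      (enatData (G.minPenalty fuel.length b v)) (penaltyTime n fuel.length) := by
  induction fuel generalizing b v with
  | nil =>
    refine .mono (run_minPenaltyBody (k := 0) le_rfl fun hb ht => ?_)
      (by simp only [List.length_nil, penaltyTime]; omega)
    have h0 : G.minPenalty 0 b v = ⊤ := by simp [Game.minPenalty, ht]
    rw [h0, enatData_top]
    exact .mono (.ite_false (.basic rfl) (by rw [eval_isTarget]; simp [ht])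
      (.ite_false (.basic rfl) (by rfl) (.basic rfl))) (by omega)
  | cons d fuel ih =>
    refine .mono (run_minPenaltyBody (k := fuel.length + 1)
      (T := choiceTime (penaltyTime n fuel.length + 2000) n + 500) (by omega) fun hb ht => ?_)
      (by simp only [List.length_cons, penaltyTime]; omega)
    rw [Game.minPenalty, if_neg hb, if_neg ht]
    have hbest := (run_bestChoice ih v (decide (v ∈ G.V₁)) b (G.succList v) 0 0 false).mono
      (choiceTime_mono _ (G.length_succList_le v))
    have harg : Code.eval (.pair (.snd (.snd (.fst .arg))) (.pair (.fst (.fst .arg))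
        (.pair (.const 0) (.pair (.const 0) (.pair (.const 0) (.pair (.snd (.fst (.snd .arg)))
          (.pair (.fst (.snd (.snd .arg))) (.snd (.snd (.snd (.snd .arg)))))))))))
        (.pair (G.vertexData v) (G.penaltyArg (d :: fuel) b v)) =
        G.choiceArg v (decide (v ∈ G.V₁)) fuel b (G.succList v) 0 0 false := by
      rw [Game.vertexData_eq, Game.choiceArg, ← Nat.cast_zero (R := ℕ∞), enatData_coe]
      rfl
    exact .mono (.ite_false (.basic rfl) (by rw [eval_isTarget]; simp [ht])
      (.ite_true (.basic rfl) (by exact Nat.one_ne_zero)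
        (.call (.basic harg) (by rfl) hbest))) (by omega)

theorem run_paretoList (G : Game n) (v : Fin n) (b : ℕ) (acc : List (ℕ∞ × ℕ∞)) :
    Run frontierProgram .paretoListBody
      (.pair (.nat b) (.pair (pairsData acc) (.pair (.nat v) G.verticesData)))
      (pairsData (G.paretoList v b acc)) ((b + 1) * (2 * penaltyTime n n + 2000)) := by
  have hval : ∀ b, Run frontierProgram .minPenaltyBody
      (.pair G.verticesData (.pair (.nat b) (.pair (.nat v) G.verticesData)))
      (enatData (G.minPenalty n b v)) (penaltyTime n n) := by
    intro b
    -- The list of vertices itself serves as fuel, being a list of length `n`.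
    have h := run_minPenalty G ((List.finRange n).map G.vertexData) b v
    rwa [List.length_map, List.length_finRange] at h
  induction b generalizing acc with
  | zero => exact .mono (.ite_false (.basic rfl) (by rfl) (.basic rfl)) (by omega)
  | succ b ih =>
    have hext : Code.extend.eval (.pair (enatData (G.minPenalty n (b + 1) v))
        (.pair (enatData (G.minPenalty n b v)) (.pair (.nat (b + 1)) (pairsData acc)))) =
        pairsData (if G.minPenalty n (b + 1) v < G.minPenalty n b v
          then ((b : ℕ∞), G.minPenalty n (b + 1) v) :: acc else acc) := by
      rw [Code.extend, Code.eval]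
      refine (if_congr (Code.eval_less _ _) ?_ ?_).trans (apply_ite pairsData _ _ _).symm
      · simp only [pairsData, List.map_cons, Data.ofList, enatData_coe]
        rfl
      · rfl
    exact .mono (.ite_true (.basic rfl) (by exact Nat.succ_ne_zero b)
      (.call (.pair (.basic rfl) (.pair (.comp (.pair (.call (.basic rfl) (by rfl) (hval (b + 1)))
        (.pair (.call (.basic rfl) (by rfl) (hval b)) (.basic rfl))) (.basic hext)) (.basic rfl)))
        (by rfl) (ih _))) (by rw [Nat.succ_mul (b + 1)]; omega)

/-- The weight bound is the sum of all atoms of the input, and its product with `n` is obtained by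
repeated addition along the list of vertices. -/
theorem run_frontier (G : Game n) (v : Fin n) :
    Run frontierProgram .frontierBody (G.toData v)
      (pairsData (G.frontier v (n * (G.toData v).sum + 1)))
      (600 * (G.toData v).size + 600 * (n + 1) + penaltyTime n n + 2000 +
        (n * (G.toData v).sum + 2) * (2 * penaltyTime n n + 2000)) := by
  have hmul := run_mul ((List.finRange n).map G.vertexData) (G.toData v).sum
  rw [List.length_map, List.length_finRange] at hmul
  have hval := run_minPenalty G ((List.finRange n).map G.vertexData)
    (n * (G.toData v).sum + 1) v
  rw [List.length_map, List.length_finRange] at hval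
  have hstart : ∀ x : ℕ∞, Code.start.eval (enatData x) =
      pairsData (if 0 < x then [(⊤, 0)] else []) := by
    intro x
    have h0 : enatData 0 = .nat 0 := enatData_coe 0
    have h := Code.eval_less 0 x
    rw [h0] at h
    rw [Code.start, Code.eval]
    refine (if_congr h ?_ ?_).trans (apply_ite pairsData _ _ _).symm
    · simp only [pairsData, List.map_cons, List.map_nil, Data.ofList, enatData_top, h0]
      rfl
    · rfl
  have hb : Run frontierProgram (.add (.const 1) (.call 3 (.pair (.snd .arg) (.call 2 .arg))))
      (G.toData v) (.nat (n * (G.toData v).sum + 1))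
      (600 * (G.toData v).size + 600 * (n + 1) + 500) := by
    rw [add_comm (n * _)]
    exact .mono (.add (y := .nat 1) (z := .nat (n * (G.toData v).sum)) (.basic rfl)
      (.call (.pair (.basic rfl) (.call (.basic rfl) (by rfl) (run_sum (G.toData v)))) (by rfl) hmul))
      (by omega)
  refine .mono (.comp (.pair hb (.basic rfl))
    (.call (.pair (.basic rfl) (.pair (.comp (.call (.basic rfl) (by rfl) hval)
      (.basic (hstart _))) (.basic rfl))) (by rfl) (run_paretoList G v _ _))) ?_
  have : n * (G.toData v).sum + 1 + 1 = n * (G.toData v).sum + 2 := rfl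
  rw [this]
  omega

/-! ## Sizes -/

theorem Data.sum_lt (d : Data) : d.sum < 2 ^ d.size := by
  induction d with
  | nat k =>
    have h1 := Nat.lt_size_self k
    have h2 : 2 ^ Nat.size k ≤ 2 ^ (1 + Nat.size k) := Nat.pow_le_pow_right (by omega) (by omega)
    exact h1.trans_le h2
  | pair a b iha ihb =>
    have h1 : 2 ^ a.size ≤ 2 ^ (a.size + b.size) := Nat.pow_le_pow_right (by omega) (by omega)
    have h2 : 2 ^ b.size ≤ 2 ^ (a.size + b.size) := Nat.pow_le_pow_right (by omega) (by omega)
    simp only [sum, size]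
    rw [add_assoc, pow_add _ 1]
    omega

theorem Data.sum_le_of_mem {a : Data} {l : List Data} (h : a ∈ l) : a.sum ≤ (ofList l).sum := by
  induction l with
  | nil => simp at h
  | cons b l ih =>
    rw [ofList, sum]
    rcases List.mem_cons.1 h with rfl | h
    · omega
    · have := ih h
      omega

theorem Data.length_le_size (l : List Data) : l.length ≤ (ofList l).size := by
  induction l with
  | nil => simp
  | cons a l ih => rw [ofList, size, List.length_cons]; omega

theorem Game.weight_le_sum (G : Game n) (v₀ v : Fin n) {u : Fin n} (hu : u ∈ G.succ v) :
    G.weight v u ≤ (G.toData v₀).sum := by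
  have h1 : G.weight v u ≤ (G.edgeData v u).sum := by simp only [edgeData, Data.sum]; omega
  have h2 : (G.edgeData v u).sum ≤ (Data.ofList ((G.succList v).map (G.edgeData v))).sum :=
    Data.sum_le_of_mem (List.mem_map_of_mem (by simp [succList, hu]))
  have h3 : (Data.ofList ((G.succList v).map (G.edgeData v))).sum ≤ (G.vertexData v).sum := by
    rw [vertexData_eq]; simp only [Data.sum]; omega
  have h4 : (G.vertexData v).sum ≤ G.verticesData.sum :=
    Data.sum_le_of_mem (List.mem_map_of_mem (List.mem_finRange v))
  have h5 : G.verticesData.sum ≤ (G.toData v₀).sum := Nat.le_add_left _ _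
  omega

theorem Game.card_le_size (G : Game n) (v₀ : Fin n) : n ≤ (G.toData v₀).size := by
  have h1 := Data.length_le_size ((List.finRange n).map G.vertexData)
  rw [List.length_map, List.length_finRange] at h1
  rw [toData, Data.size]
  omega

/-- With `V` bounding one evaluation of the least penalty and `Y = 2 ^ s * 2 ^ s` bounding `n * S`,
everything is at most a constant times `V * Y`, and `2 ^ (2 * s + 12)` is `4096 * Y`. The summand
`101` pays for the initial call. -/
theorem time_le {n s S : ℕ} (hn : n ≤ s) (hS : S < 2 ^ s) :
    600 * s + 600 * (n + 1) + penaltyTime n n + 2000 + (n * S + 2) * (2 * penaltyTime n n + 2000)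
      + 101 ≤ 2 ^ ((2 * s + 12) * (s + 1) + (2 * s + 12)) := by
  have hV : penaltyTime n n + 2000 ≤ 2 ^ ((2 * s + 12) * (s + 1)) :=
    (penaltyTime_add_le n n).trans (Nat.pow_le_pow_right (by omega)
      (Nat.mul_le_mul (by omega) (by omega)))
  set V := 2 ^ ((2 * s + 12) * (s + 1))
  have hs : s < 2 ^ s := Nat.lt_two_pow_self
  have h1 : n * S ≤ 2 ^ s * 2 ^ s := Nat.mul_le_mul (by omega) hS.le
  have h2 : 2 ^ (2 * s + 12) = 4096 * (2 ^ s * 2 ^ s) := by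
    rw [pow_add, two_mul, pow_add]; ring
  have h3 : 2 ^ s ≤ 2 ^ s * 2 ^ s := Nat.le_mul_of_pos_right _ (by positivity)
  have h0 : 2 ^ ((2 * s + 12) * (s + 1) + (2 * s + 12)) = V * 2 ^ (2 * s + 12) := pow_add _ _ _
  rw [h0, h2]
  clear_value V
  generalize 2 ^ s * 2 ^ s = Y at *
  have hY : 1 ≤ Y := by omega
  have h4 : (n * S + 2) * (2 * penaltyTime n n + 2000) ≤ (3 * Y) * (2 * V) :=
    Nat.mul_le_mul (by omega) (by omega)
  have h5 : Y ≤ V * Y := Nat.le_mul_of_pos_left _ (by omega)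
  have h6 : V ≤ V * Y := Nat.le_mul_of_pos_right _ hY
  have h7 : (3 * Y) * (2 * V) = 6 * (V * Y) := by ring
  have h8 : V * (4096 * Y) = 4096 * (V * Y) := by ring
  omega

end PermissiveReach

open PermissiveReach in
theorem mainTheorem12 :
    ∃ (P : PermissiveReach.Program) (q : Polynomial ℕ),
      ∀ (n : ℕ) (G : PermissiveReach.Game n) (v₀ : Fin n),
        ∃ (L : List (ℕ∞ × ℕ∞)) (t : ℕ),
          L.Nodup ∧ (∀ x, x ∈ L ↔ x ∈ G.pareto v₀) ∧
          P.Computes (G.toData v₀) (PermissiveReach.pairsData L) t ∧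
          t ≤ 2 ^ q.eval (G.toData v₀).size := by
  refine ⟨frontierProgram, (2 * .X + 12) * (.X + 1) + (2 * .X + 12), fun n G v₀ => ?_⟩
  obtain ⟨t, ht, h⟩ := Run.call (P := frontierProgram) (e := .arg) (i := 0)
    (.basic rfl) rfl (run_frontier G v₀)
  refine ⟨_, t, G.nodup_frontier v₀ _,
    Game.mem_frontier_iff fun v u hu => G.weight_le_sum v₀ v hu, h, ?_⟩
  have hle := time_le (G.card_le_size v₀) (G.toData v₀).sum_lt
  simp only [Polynomial.eval_add, Polynomial.eval_mul, Polynomial.eval_X, Polynomial.eval_ofNat,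
    Polynomial.eval_one]
  omega
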